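/- Let $(\Sigma,\mu)$ be a $\sigma$-finite measure space, $1\le q<\infty$, $1\le r\le\infty$, $\varrho\ge 0$, $\sigma>0$, $C>0$, $\omega\ge 0$, and write $L^q=L^q(\Sigma,\mu)$ (real-valued functions). Operators are multivalued and identified with their graphs $A\subseteq L^q\times L^q$. *Definitions.* An operator $B$ on $L^q$ is *completely accretive* if for all $\lambda>0$, all $(u,v),(\hat u,\hat v)\in B$ and all convex, lower semicontinuous $j:\mathbb R\to[0,\infty]$ with $j(0)=0$ one has $\int_\Sigma j(u-\hat u)\,d\mu\le\int_\Sigma j(u-\hat u+\lambda(v-\hat v))\,d\mu$; it is *$m$-completely accretive* if moreover $\mathrm{Rg}(I+\lambda B)=L^q$ for some $\lambda>0$. For $u,v\in L^q$ let $[u,v]_q=\lim_{\lambda\to0+}\frac{1}{\lambda}\big(\frac1q\|u+\lambda v\|_q^q-\frac1q\|u\|_q^q\big)=\inf_{\lambda>0}\frac{1}{\lambda}\big(\frac1q\|u+\lambda v\|_q^q-\frac1q\|u\|_q^q\big)$. *Assumptions.* Let $A$ be an operator on $L^q$ with dense domain such that $A+\omega I$ is $m$-completely accretive, and suppose that $A$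 satisfies the Gagliardo–Nirenberg type inequality with differences $$\|u-\hat u\|_r^\sigma\le C\Big([u-\hat u,v-\hat v]_q+\omega\|u-\hat u\|_q^q\Big)\|u-\hat u\|_q^\varrho\qquad\text{for all }(u,v),(\hat u,\hat v)\in A$$ (in particular $u-\hat u\in L^r$). *Conclusion.* The semigroup $\{T_t\}_{t\ge0}$ generated by $-A$ on $L^q$, given by the exponential formula $T_tu=\lim_{n\to\infty}(I+\frac tnA)^{-n}u$ (the limit exists in $L^q$ for all $t\ge0$, $u\in L^q$), satisfies, with $\gamma=\frac{q+\varrho}{\sigma}$, $$\|T_tu-T_t\hat u\|_r\le\Big(\frac Cq\Big)^{1/\sigma}t^{-1/\sigma}e^{\omega(\gamma+1)t}\|u-\hat u\|_q^\gamma\qquad\text{for all }t>0,\ u,\hat u\in L^q.$$ Suppose moreover that $r<\infty$, $\gamma r>q$, and that there is $u_0\in L^1\cap L^\infty$ with $(u_0,0)\in A$. Let $m_0\ge q\gamma^{-1}$ satisfy $$D:=\Big(\frac{\gamma r}{q}-1\Big)m_0+q\Big(\frac1\gamma-1\Big)>0,$$ and let $1\le s\le\frac{\gamma r}{q}m_0$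 satisfy $\gamma\big(1-\frac{sq}{\gamma rm_0}\big)<1$. Then every $T_t$, $t\ge0$, has a (unique) continuous extension from $L^q\cap L^s$ to $L^s$, again denoted by $T_t$, and $$\|T_tu-T_t\hat u\|_\infty\le K\,t^{-\alpha_s}e^{\omega\beta_st}\|u-\hat u\|_s^{\gamma_s}\qquad\text{for all }t>0,\ u,\hat u\in L^s,$$ where $K$ depends only on $q,r,\varrho,\sigma,C,m_0,s$ and, with $\theta_s=\frac{sq}{\gamma rm_0}$, $$\alpha^*=\frac{\sigma^{-1}q\gamma^{-1}}{D},\quad\beta^*=\frac{\gamma^2rq^{-1}-1}{D}+1,\quad\gamma^*=\frac{(\gamma rq^{-1}-1)m_0}{D},$$ $$\alpha_s=\frac{\alpha^*}{1-\gamma^*(1-\theta_s)},\quad\beta_s=\frac{\beta^*/2+\gamma^*\theta_s}{1-\gamma^*(1-\theta_s)},\quad\gamma_s=\frac{\gamma^*\theta_s}{1-\gamma^*(1-\theta_s)}.$$ -/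

import Mathlib

open MeasureTheory Filter Topology
open scoped ENNReal NNReal

namespace NonlinearSemigroup

section Operators

/-! Multivalued operators on a normed space `X` are identified with their graphs,
that is, with subsets `A` of `X × X`. -/

/-- The effective domain `D(A)`. -/
def effDomain {X : Type*} (A : Set (X × X)) : Set X :=
  {u | ∃ v, (u, v) ∈ A}

/-- The operator `A + ω I`. -/
def addScalarId {X : Type*} [AddCommGroup X] [Module ℝ X] (A : Set (X × X)) (ω : ℝ) :
    Set (X × X) :=
  {p | ∃ v, (p.1, v) ∈ A ∧ p.2 = v + ω • p.1}

/-- The range `Rg(I + lam A)`. -/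
def rangeIdAdd {X : Type*} [AddCommGroup X] [Module ℝ X] (A : Set (X × X)) (lam : ℝ) : Set X :=
  {f | ∃ u v, (u, v) ∈ A ∧ u + lam • v = f}

open scoped Classical in
/-- The resolvent `(I + lam A)⁻¹`, as a map. For `f ∈ Rg(I + lam A)` it selects a solution `u` of
`u + lam A u ∋ f` (the only one, when `A + ω I` is accretive and `0 < lam`, `lam ω < 1`); outside
of the range, which does not occur for small `lam > 0` when `A + ω I` is `m`-accretive, it
returns `f`. -/
noncomputable def resolvent {X : Type*} [AddCommGroup X] [Module ℝ X] (A : Set (X × X))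
    (lam : ℝ) (f : X) : X :=
  if h : ∃ u v, (u, v) ∈ A ∧ u + lam • v = f then h.choose else f

/-- The approximation `(I + (t/n) A)^{-n} u` of the mild solution of `u' + A u ∋ 0`, `u(0) = u`. -/
noncomputable def expApprox {X : Type*} [AddCommGroup X] [Module ℝ X] (A : Set (X × X))
    (t : ℝ) (u : X) (n : ℕ) : X :=
  (resolvent A (t / n))^[n] u

/-- The semigroup generated by `-A`, through the exponential formula
`T_t u = lim_n (I + (t/n) A)^{-n} u`. -/
noncomputable def semigroup {X : Type*} [NormedAddCommGroup X] [NormedSpace ℝ X]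
    (A : Set (X × X)) (t : ℝ) (u : X) : X :=
  limUnder atTop (expApprox A t u)

end Operators

section CompleteAccretivity

variable {Ω : Type*} [MeasurableSpace Ω] {μ : Measure Ω} {q : ℝ≥0∞}

/-- The class `𝒥₀` of convex, lower semicontinuous `j : ℝ → [0, ∞]` with `j 0 = 0`. -/
structure IsJ0 (j : ℝ → ℝ≥0∞) : Prop where
  convex : ConvexOn ℝ≥0 Set.univ j
  lsc : LowerSemicontinuous j
  zero : j 0 = 0

/-- `A` is completely accretive: for every `lam > 0` the resolvent `(I + lam A)⁻¹` is a complete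
contraction, that is, `∫ j (u - u') ≤ ∫ j (f - f')` for all `j ∈ 𝒥₀` whenever
`f = u + lam v`, `f' = u' + lam v'` with `(u, v), (u', v') ∈ A`. (With `j = |·|` this contains
that the resolvent is single-valued.) -/
def IsCompletelyAccretive (A : Set (Lp ℝ q μ × Lp ℝ q μ)) : Prop :=
  ∀ lam : ℝ, 0 < lam → ∀ j : ℝ → ℝ≥0∞, IsJ0 j →
    ∀ u v u' v' : Lp ℝ q μ, (u, v) ∈ A → (u', v') ∈ A →
      ∫⁻ x, j ((u - u' : Lp ℝ q μ) x) ∂μ ≤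
        ∫⁻ x, j (((u + lam • v) - (u' + lam • v') : Lp ℝ q μ) x) ∂μ

/-- `A` is `m`-completely accretive in `L^q`: completely accretive, and `Rg(I + lam A) = L^q` for
some `lam > 0`. -/
def IsMCompletelyAccretive (A : Set (Lp ℝ q μ × Lp ℝ q μ)) : Prop :=
  IsCompletelyAccretive A ∧ ∃ lam : ℝ, 0 < lam ∧ rangeIdAdd A lam = Set.univ

/-- The `q`-bracket `[u, v]_q`, the right-hand derivative at `0` of the convex function
`lam ↦ (1/q) ‖u + lam v‖_q^q`, that is, the infimum (and the limit as `lam → 0+`) of its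
difference quotients, which are nondecreasing in `lam` and bounded below by convexity. -/
noncomputable def qBracket (u v : Lp ℝ q μ) : ℝ :=
  ⨅ lam : Set.Ioi (0 : ℝ),
    (q.toReal⁻¹ * ‖u + (lam : ℝ) • v‖ ^ q.toReal - q.toReal⁻¹ * ‖u‖ ^ q.toReal) / (lam : ℝ)

/-- The `L^q`-`L^r` Gagliardo–Nirenberg type inequality with differences
`‖u - u'‖_r^σ ≤ C ([u - u', v - v']_q + ω ‖u - u'‖_q^q) ‖u - u'‖_q^ρ` on `A`, with constant `C`;
it includes that its left-hand side is finite. -/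
def GagliardoNirenberg (A : Set (Lp ℝ q μ × Lp ℝ q μ)) (r : ℝ≥0∞) (ρ σ ω C : ℝ) : Prop :=
  ∀ u v u' v' : Lp ℝ q μ, (u, v) ∈ A → (u', v') ∈ A →
    MemLp (u - u' : Lp ℝ q μ) r μ ∧
    (eLpNorm (u - u' : Lp ℝ q μ) r μ).toReal ^ σ ≤
      C * (qBracket (u - u') (v - v') + ω * ‖u - u'‖ ^ q.toReal) * ‖u - u'‖ ^ ρ

/-- `S'` is a continuous map on `L^s` that agrees with the map `S` of `L^q` on `L^q ∩ L^s`. For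
`s < ∞`, where `L^q ∩ L^s` is dense in `L^s`, there is at most one such `S'`. -/
def IsContinuousExtension {s : ℝ≥0∞} [Fact (1 ≤ s)] (S : Lp ℝ q μ → Lp ℝ q μ)
    (S' : Lp ℝ s μ → Lp ℝ s μ) : Prop :=
  Continuous S' ∧ ∀ (u : Lp ℝ q μ) (w : Lp ℝ s μ), u =ᵐ[μ] w → S' w =ᵐ[μ] S u

end CompleteAccretivity

section Exponents

/-- `(γ r / q - 1) m₀ + q (1 / γ - 1)`. -/
noncomputable def expDenom (q r γ m₀ : ℝ) : ℝ :=
  (γ * r / q - 1) * m₀ + q * (1 / γ - 1)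

noncomputable def alphaStar (q r σ γ m₀ : ℝ) : ℝ :=
  (σ⁻¹ * q * γ⁻¹) / expDenom q r γ m₀

noncomputable def betaStar (q r γ m₀ : ℝ) : ℝ :=
  (γ ^ 2 * r / q - 1) / expDenom q r γ m₀ + 1

noncomputable def gammaStar (q r γ m₀ : ℝ) : ℝ :=
  ((γ * r / q - 1) * m₀) / expDenom q r γ m₀

/-- `s q / (γ r m₀)`. -/
noncomputable def thetaS (q r γ m₀ s : ℝ) : ℝ :=
  s * q / (γ * r * m₀)

noncomputable def alphaS (q r σ γ m₀ s : ℝ) : ℝ :=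
  alphaStar q r σ γ m₀ / (1 - gammaStar q r γ m₀ * (1 - thetaS q r γ m₀ s))

noncomputable def betaS (q r γ m₀ s : ℝ) : ℝ :=
  (betaStar q r γ m₀ / 2 + gammaStar q r γ m₀ * thetaS q r γ m₀ s) /
    (1 - gammaStar q r γ m₀ * (1 - thetaS q r γ m₀ s))

noncomputable def gammaS (q r γ m₀ s : ℝ) : ℝ :=
  (gammaStar q r γ m₀ * thetaS q r γ m₀ s) /
    (1 - gammaStar q r γ m₀ * (1 - thetaS q r γ m₀ s))

end Exponents

end NonlinearSemigroup

/-! The resolvents of `A` with step h are Lipschitz in L^q with constant (1 - hω)⁻¹, and Kobayashi's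
inequality compares two implicit Euler schemes with different steps. Hence the exponential formula
converges and yields a semigroup. Complete accretivity gives the same Lipschitz constants in every
L^p, 1 ≤ p ≤ ∞, and these pass to T_t because L^p norms are lower semicontinuous under L^q
convergence.

The L^q-L^r estimate is a telescoping sum along the Euler scheme. The q-bracket is at most a
backward difference quotient of ‖·‖_q^q / q, so summing the Gagliardo–Nirenberg inequality over n
steps bounds a sum of ‖w_k‖_r^σ, and the last of these norms is, up to the growth factor, at most
each of the others (`eLpNorm_iterate_sub_le_of_gagliardoNirenberg`).

The L^s-L^∞ estimate is a De Giorgi iteration on truncations. A difference that is small in L^r is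
cut at a height: the bounded part is charged to the L^∞ distance, the rest is small in L^q since r >
q. With times and heights halved at every step the L^q error decays geometrically because γr > q,
while the heights sum to 2k (`IsRegularizing.eLpNorm_top_le_of_near`). For s ≥ q the initial
difference is truncated at the optimal k. For s < q the L^q norm is interpolated between L^s and
L^∞, and the resulting power δ < 1 of the L^∞ norm is absorbed (`le_rpow_of_le_mul_rpow_half`).

The parameter m₀ cancels from α_s and γ_s. It survives only in β_s > γ_s, and every growth exponent
above γ_s is attainable, since most of the time can be spent under the L^s Lipschitz bound. If γ >
1, Hölder continuity with exponent above one makes every T_t with t > 0 constant, which forces μ =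
0. -/

namespace NonlinearSemigroup

/-! ### Quasi-m-accretive operators: resolvents and the Kobayashi inequality -/

section Banach

variable {X : Type*} [NormedAddCommGroup X] [NormedSpace ℝ X]

/-- `A + ω I` is accretive, expressed through the resolvents of `A`. -/
def IsQuasiAccretive (A : Set (X × X)) (ω : ℝ) : Prop :=
  ∀ h : ℝ, 0 < h → h * ω < 1 → ∀ u v u' v' : X, (u, v) ∈ A → (u', v') ∈ A →
    (1 - h * ω) * ‖u - u'‖ ≤ ‖(u + h • v) - (u' + h • v')‖

/-- `A + ω I` is `m`-accretive, expressed through the resolvents of `A`. -/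
structure IsQuasiMAccretive (A : Set (X × X)) (ω : ℝ) : Prop where
  nonneg : 0 ≤ ω
  accretive : IsQuasiAccretive A ω
  range : ∀ h : ℝ, 0 < h → h * ω < 1 → rangeIdAdd A h = Set.univ

/-- With J the resolvent at `l₀`, the equation u + l v = f is the fixed point problem u = J((l₀/l) f
+ (1 - l₀/l) u). It is a contraction because |1 - l₀/l| < 1 when l > l₀/2. -/
theorem rangeIdAdd_eq_univ_of_half_lt [CompleteSpace X] {B : Set (X × X)}
    (hB : IsQuasiAccretive B 0) {l₀ l : ℝ} (hl₀ : 0 < l₀) (hr : rangeIdAdd B l₀ = Set.univ)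
    (hl : l₀ / 2 < l) : rangeIdAdd B l = Set.univ := by
  have hl0 : 0 < l := by linarith
  have hex : ∀ f : X, ∃ u v, (u, v) ∈ B ∧ u + l₀ • v = f := fun f => by
    have : f ∈ rangeIdAdd B l₀ := by rw [hr]; trivial
    exact this
  choose J V hJ hJV using hex
  have hlip : ∀ f g, ‖J f - J g‖ ≤ ‖f - g‖ := fun f g => by
    have := hB l₀ hl₀ (by simp) _ _ _ _ (hJ f) (hJ g)
    simpa [hJV] using this
  rw [Set.eq_univ_iff_forall]
  intro f
  set c : ℝ := 1 - l₀ / l with hc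
  have hcabs : |c| < 1 := by
    rw [abs_lt]
    constructor
    · have : l₀ / l < 2 := by rw [div_lt_iff₀ hl0]; linarith
      linarith
    · have : 0 < l₀ / l := by positivity
      linarith
  let Φ : X → X := fun u => J ((l₀ / l) • f + c • u)
  have hΦ : ContractingWith ⟨|c|, abs_nonneg c⟩ Φ := by
    refine ⟨by exact_mod_cast hcabs, LipschitzWith.of_dist_le_mul fun x y => ?_⟩
    rw [dist_eq_norm, dist_eq_norm]
    refine (hlip _ _).trans ?_
    rw [add_sub_add_left_eq_sub, ← smul_sub, norm_smul]
    exact le_rfl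
  obtain ⟨u, hu⟩ : ∃ u, Φ u = u := ⟨_, hΦ.fixedPoint_isFixedPt⟩
  have h1 := hJ ((l₀ / l) • f + c • u)
  have h2 := hJV ((l₀ / l) • f + c • u)
  change J _ = u at hu
  rw [hu] at h1 h2
  refine ⟨u, _, h1, ?_⟩
  set v := V ((l₀ / l) • f + c • u)
  have h3 : l₀ • v = (l₀ / l) • f - (l₀ / l) • u := by
    have : l₀ • v = (l₀ / l) • f + c • u - u := by rw [← h2]; abel
    rw [this, hc]; module
  have h4 : l • v = (l / l₀) • (l₀ • v) := by
    rw [smul_smul]; congr 1; field_simp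
  rw [h4, h3, smul_sub, smul_smul, smul_smul]
  have : l / l₀ * (l₀ / l) = 1 := by field_simp
  rw [this]; simp

/-- The parameter may shrink by any ratio above 1/2. Powers of 2/3 bring it below `l`, and one last
step reaches `l`. -/
theorem rangeIdAdd_eq_univ [CompleteSpace X] {B : Set (X × X)}
    (hB : IsQuasiAccretive B 0) {l₀ : ℝ} (hl₀ : 0 < l₀) (hr : rangeIdAdd B l₀ = Set.univ)
    {l : ℝ} (hl : 0 < l) : rangeIdAdd B l = Set.univ := by
  have key : ∀ n : ℕ, rangeIdAdd B (l₀ * (2 / 3) ^ n) = Set.univ := by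
    intro n
    induction n with
    | zero => simpa using hr
    | succ n ih =>
      have : 0 < l₀ * (2 / 3) ^ n := by positivity
      refine rangeIdAdd_eq_univ_of_half_lt hB this ih ?_
      rw [pow_succ]; linarith
  obtain ⟨n, hn⟩ := exists_pow_lt_of_lt_one (div_pos hl hl₀) (by norm_num : (2 / 3 : ℝ) < 1)
  rw [lt_div_iff₀ hl₀] at hn
  have h0 : 0 < l₀ * (2 / 3 : ℝ) ^ n := by positivity
  exact rangeIdAdd_eq_univ_of_half_lt hB h0 (key n) (by linarith)

/-- Divided by 1 - hω, the resolvent equation of `A` with step h becomes that of A + ωI with step h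
/ (1 - hω). -/
theorem IsQuasiMAccretive.of_addScalarId [CompleteSpace X] {A : Set (X × X)} {ω : ℝ}
    (hω : 0 ≤ ω) (hacc : IsQuasiAccretive A ω) (hB : IsQuasiAccretive (addScalarId A ω) 0)
    (hr : ∃ lam : ℝ, 0 < lam ∧ rangeIdAdd (addScalarId A ω) lam = Set.univ) :
    IsQuasiMAccretive A ω := by
  refine ⟨hω, hacc, fun h hh hhω => ?_⟩
  obtain ⟨l₀, hl₀, hl⟩ := hr
  have hpos : 0 < 1 - h * ω := by linarith
  have hl' := rangeIdAdd_eq_univ hB hl₀ hl (div_pos hh hpos)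
  rw [Set.eq_univ_iff_forall] at hl' ⊢
  intro f
  obtain ⟨u, v, ⟨v', hv', hv⟩, huv⟩ := hl' ((1 - h * ω)⁻¹ • f)
  simp only at hv' hv
  refine ⟨u, v', hv', ?_⟩
  have hf : f = (1 - h * ω) • ((1 - h * ω)⁻¹ • f) := by
    rw [smul_smul, mul_inv_cancel₀ hpos.ne', one_smul]
  rw [hf, ← huv, hv, smul_add, smul_smul, mul_div_cancel₀ _ hpos.ne']
  module

theorem resolvent_zero (A : Set (X × X)) (f : X) : resolvent A 0 f = f := by
  unfold resolvent
  split_ifs with h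
  · obtain ⟨v, -, hv⟩ := h.choose_spec
    simpa using hv
  · rfl

variable {A : Set (X × X)} {ω : ℝ}

theorem IsQuasiMAccretive.resolvent_spec (hA : IsQuasiMAccretive A ω) {h : ℝ} (hh : 0 < h)
    (hω : h * ω < 1) (f : X) : ∃ v, (resolvent A h f, v) ∈ A ∧ resolvent A h f + h • v = f := by
  have hex : ∃ u v, (u, v) ∈ A ∧ u + h • v = f := by
    have : f ∈ rangeIdAdd A h := by rw [hA.range h hh hω]; trivial
    exact this
  unfold resolvent
  rw [dif_pos hex]
  exact hex.choose_spec

theorem IsQuasiMAccretive.norm_resolvent_sub_le (hA : IsQuasiMAccretive A ω) {h : ℝ} (hh : 0 < h)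
    (hω : h * ω < 1) (f g : X) :
    (1 - h * ω) * ‖resolvent A h f - resolvent A h g‖ ≤ ‖f - g‖ := by
  obtain ⟨v, hv, hf⟩ := hA.resolvent_spec hh hω f
  obtain ⟨w, hw, hg⟩ := hA.resolvent_spec hh hω g
  have := hA.accretive h hh hω _ _ _ _ hv hw
  rwa [hf, hg] at this

theorem IsQuasiMAccretive.resolvent_eq (hA : IsQuasiMAccretive A ω) {h : ℝ} (hh : 0 < h)
    (hω : h * ω < 1) {u v : X} (huv : (u, v) ∈ A) : resolvent A h (u + h • v) = u := by
  obtain ⟨w, hw, hf⟩ := hA.resolvent_spec hh hω (u + h • v)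
  have := hA.accretive h hh hω _ _ _ _ hw huv
  rw [hf, sub_self, norm_zero] at this
  have h1 : ‖resolvent A h (u + h • v) - u‖ ≤ 0 := by
    by_contra hcon
    push Not at hcon
    have : 0 < 1 - h * ω := by linarith
    have := mul_pos this hcon
    linarith
  exact sub_eq_zero.1 (norm_le_zero_iff.1 h1)

theorem IsQuasiMAccretive.norm_iterate_sub_le (hA : IsQuasiMAccretive A ω) {h : ℝ} (hh : 0 < h)
    (hω : h * ω < 1) (n : ℕ) (f g : X) :
    (1 - h * ω) ^ n * ‖(resolvent A h)^[n] f - (resolvent A h)^[n] g‖ ≤ ‖f - g‖ := by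
  have hpos : 0 < 1 - h * ω := by linarith
  induction n with
  | zero => simp
  | succ n ih =>
    rw [Function.iterate_succ_apply', Function.iterate_succ_apply', pow_succ, mul_assoc]
    refine le_trans ?_ ih
    gcongr
    exact hA.norm_resolvent_sub_le hh hω _ _

theorem IsQuasiMAccretive.norm_iterate_sub_self_le (hA : IsQuasiMAccretive A ω) {h : ℝ}
    (hh : 0 < h) (hω : h * ω < 1) {x v : X} (hx : (x, v) ∈ A) (n : ℕ) :
    (1 - h * ω) ^ n * ‖(resolvent A h)^[n] x - x‖ ≤ n * h * ‖v‖ := by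
  have hpos : 0 < 1 - h * ω := by linarith
  have hle : 1 - h * ω ≤ 1 := by nlinarith [hA.nonneg]
  have h1 : (1 - h * ω) * ‖resolvent A h x - x‖ ≤ h * ‖v‖ := by
    have := hA.norm_resolvent_sub_le hh hω x (x + h • v)
    rw [hA.resolvent_eq hh hω hx] at this
    simpa [norm_smul, abs_of_pos hh] using this
  induction n with
  | zero => simp
  | succ n ih =>
    have h2 := hA.norm_iterate_sub_le hh hω n (resolvent A h x) x
    rw [← Function.iterate_succ_apply] at h2
    have h3 : ‖(resolvent A h)^[n + 1] x - x‖ ≤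
        ‖(resolvent A h)^[n + 1] x - (resolvent A h)^[n] x‖ + ‖(resolvent A h)^[n] x - x‖ :=
      norm_sub_le_norm_sub_add_norm_sub _ _ _
    calc (1 - h * ω) ^ (n + 1) * ‖(resolvent A h)^[n + 1] x - x‖
        ≤ (1 - h * ω) * ((1 - h * ω) ^ n * ‖(resolvent A h)^[n + 1] x - (resolvent A h)^[n] x‖) +
          (1 - h * ω) * ((1 - h * ω) ^ n * ‖(resolvent A h)^[n] x - x‖) := by
          rw [pow_succ', ← mul_add, ← mul_add, mul_assoc]
          gcongr
      _ ≤ (1 - h * ω) * ‖resolvent A h x - x‖ +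
          1 * ((1 - h * ω) ^ n * ‖(resolvent A h)^[n] x - x‖) := by gcongr
      _ ≤ h * ‖v‖ + n * h * ‖v‖ := by linarith
      _ = _ := by push_cast; ring

/-- The Kobayashi inequality comparing one step of two implicit Euler schemes. -/
theorem IsQuasiMAccretive.norm_resolvent_sub_resolvent_le (hA : IsQuasiMAccretive A ω) {l m : ℝ}
    (hl : 0 < l) (hlω : l * ω < 1) (hm : 0 < m) (hmω : m * ω < 1) (f g : X) :
    (1 - l * m / (l + m) * ω) * ‖resolvent A l f - resolvent A m g‖ ≤
      l / (l + m) * ‖resolvent A l f - g‖ + m / (l + m) * ‖f - resolvent A m g‖ := by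
  have hlm : 0 < l + m := by linarith
  obtain ⟨v, hv, hf⟩ := hA.resolvent_spec hl hlω f
  obtain ⟨w, hw, hg⟩ := hA.resolvent_spec hm hmω g
  have hη : 0 < l * m / (l + m) := by positivity
  have hηm : l * m / (l + m) ≤ m := by
    rw [div_le_iff₀ hlm]; nlinarith [mul_pos hm hm]
  -- At the parameter lm/(l+m), the harmonic combination of the two steps, the right-hand side of
  -- accretivity splits into a convex combination of the two older differences.
  have := hA.accretive _ hη (lt_of_le_of_lt (mul_le_mul_of_nonneg_right hηm hA.nonneg) hmω)
    _ _ _ _ hv hw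
  refine this.trans ?_
  have heq : (resolvent A l f + (l * m / (l + m)) • v) -
      (resolvent A m g + (l * m / (l + m)) • w) =
      (l / (l + m)) • (resolvent A l f - g) + (m / (l + m)) • (f - resolvent A m g) := by
    set a := resolvent A l f
    set b := resolvent A m g
    rw [← hf, ← hg]
    have e1 : l * m / (l + m) = (m / (l + m)) * l := by ring
    have e2 : l / (l + m) = 1 - m / (l + m) := by field_simp; ring
    have e3 : (l * m / (l + m)) • w = (l / (l + m)) • (m • w) := by
      rw [smul_smul]; congr 1; ring
    rw [e3, e1, e2]
    module
  rw [heq]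
  refine (norm_add_le _ _).trans ?_
  rw [norm_smul, norm_smul, Real.norm_of_nonneg (by positivity), Real.norm_of_nonneg (by positivity)]

/-- Concavity of the square root; it closes the double induction in Kobayashi's estimate. -/
theorem weighted_sqrt_le {l m x y : ℝ} (hl : 0 < l) (hm : 0 < m) (hx : 0 ≤ x) (hy : 0 ≤ y) :
    l / (l + m) * √x + m / (l + m) * √y ≤ √((l * x + m * y) / (l + m)) := by
  apply Real.le_sqrt_of_sq_le
  have hlm : 0 < l + m := by linarith
  have h1 : (l / (l + m) * √x + m / (l + m) * √y) ^ 2 = (l * √x + m * √y) ^ 2 / (l + m) ^ 2 := by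
    field_simp
  rw [h1, div_le_div_iff₀ (by positivity) hlm]
  have h2 : (l * √x + m * √y) ^ 2 ≤ (l * x + m * y) * (l + m) := by
    have h3 := mul_nonneg (mul_pos hl hm).le (sq_nonneg (√x - √y))
    have h4 : (l * x + m * y) * (l + m) =
        (l * √x + m * √y) ^ 2 + l * m * (√x - √y) ^ 2 := by
      conv_lhs => rw [← Real.sq_sqrt hx, ← Real.sq_sqrt hy]
      ring
    linarith
  nlinarith

/-- Kobayashi's estimate for two implicit Euler schemes with the same initial value. -/
theorem IsQuasiMAccretive.kobayashi (hA : IsQuasiMAccretive A ω) {l m : ℝ}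
    (hl : 0 < l) (hlω : l * ω < 1) (hm : 0 < m) (hmω : m * ω < 1) {x v : X} (hx : (x, v) ∈ A)
    (k j : ℕ) :
    (1 - l * ω) ^ k * (1 - m * ω) ^ j * ‖(resolvent A l)^[k] x - (resolvent A m)^[j] x‖ ≤
      ‖v‖ * √((k * l - j * m) ^ 2 + k * l ^ 2 + j * m ^ 2) := by
  have hc : 0 < 1 - l * ω := by linarith
  have hd : 0 < 1 - m * ω := by linarith
  have hω := hA.nonneg
  have hlm : 0 < l + m := by linarith
  induction k generalizing j with
  | zero =>
    simp only [pow_zero, one_mul, Function.iterate_zero, id_eq, CharP.cast_eq_zero, zero_mul,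
      zero_sub, add_zero]
    rw [norm_sub_rev]
    refine (hA.norm_iterate_sub_self_le hm hmω hx j).trans ?_
    rw [mul_comm]
    gcongr
    apply Real.le_sqrt_of_sq_le
    have : (0 : ℝ) ≤ j * m ^ 2 := by positivity
    linarith [neg_sq (j * m : ℝ)]
  | succ k ihk =>
    induction j with
    | zero =>
      simp only [pow_zero, mul_one, Function.iterate_zero, id_eq, CharP.cast_eq_zero, zero_mul,
        sub_zero, add_zero]
      refine (hA.norm_iterate_sub_self_le hl hlω hx (k + 1)).trans ?_
      rw [mul_comm]
      gcongr
      apply Real.le_sqrt_of_sq_le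
      have : (0 : ℝ) ≤ ((k + 1 : ℕ) : ℝ) * l ^ 2 := by positivity
      linarith
    | succ j ihj =>
      have h1 := ihk (j + 1)
      have h2 := ihj
      set a₁ := ‖(resolvent A l)^[k + 1] x - (resolvent A m)^[j] x‖ with ha₁
      set a₂ := ‖(resolvent A l)^[k] x - (resolvent A m)^[j + 1] x‖ with ha₂
      set a := ‖(resolvent A l)^[k + 1] x - (resolvent A m)^[j + 1] x‖ with ha
      set η := l * m / (l + m) with hη
      have hηm : η ≤ m := by rw [hη, div_le_iff₀ hlm]; nlinarith [mul_pos hm hm]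
      have hηl : η ≤ l := by rw [hη, div_le_iff₀ hlm]; nlinarith [mul_pos hl hl]
      have hstep : (1 - η * ω) * a ≤ l / (l + m) * a₁ + m / (l + m) * a₂ := by
        rw [ha, ha₁, ha₂, Function.iterate_succ_apply' _ k, Function.iterate_succ_apply' _ j]
        exact hA.norm_resolvent_sub_resolvent_le hl hlω hm hmω _ _
      have hdη : 1 - m * ω ≤ 1 - η * ω := by
        have := mul_le_mul_of_nonneg_right hηm hω; linarith
      have hcη : 1 - l * ω ≤ 1 - η * ω := by
        have := mul_le_mul_of_nonneg_right hηl hω; linarith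
      have hpη : 0 < 1 - η * ω := by linarith
      set b₁ := (1 - l * ω) ^ (k + 1) * (1 - m * ω) ^ j * a₁ with hb₁
      set b₂ := (1 - l * ω) ^ k * (1 - m * ω) ^ (j + 1) * a₂ with hb₂
      have hb₁0 : 0 ≤ b₁ := by positivity
      have hb₂0 : 0 ≤ b₂ := by positivity
      have hb : (1 - l * ω) ^ (k + 1) * (1 - m * ω) ^ (j + 1) * a ≤
          l / (l + m) * b₁ + m / (l + m) * b₂ := by
        -- The factor 1 - ηω makes the one-step inequality applicable; since it dominates both 1 -
        -- lω and 1 - mω, it can be cancelled afterwards.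
        refine le_of_mul_le_mul_left ?_ hpη
        calc (1 - η * ω) * ((1 - l * ω) ^ (k + 1) * (1 - m * ω) ^ (j + 1) * a)
            = (1 - l * ω) ^ (k + 1) * (1 - m * ω) ^ (j + 1) * ((1 - η * ω) * a) := by ring
          _ ≤ (1 - l * ω) ^ (k + 1) * (1 - m * ω) ^ (j + 1) *
              (l / (l + m) * a₁ + m / (l + m) * a₂) := by gcongr
          _ = l / (l + m) * ((1 - m * ω) * b₁) + m / (l + m) * ((1 - l * ω) * b₂) := by
              rw [hb₁, hb₂]; ring
          _ ≤ l / (l + m) * ((1 - η * ω) * b₁) + m / (l + m) * ((1 - η * ω) * b₂) := by gcongr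
          _ = _ := by ring
      refine hb.trans ?_
      calc l / (l + m) * b₁ + m / (l + m) * b₂
          ≤ l / (l + m) * (‖v‖ * √((((k + 1 : ℕ) : ℝ) * l - j * m) ^ 2 +
              ((k + 1 : ℕ) : ℝ) * l ^ 2 + j * m ^ 2)) +
            m / (l + m) * (‖v‖ * √((k * l - ((j + 1 : ℕ) : ℝ) * m) ^ 2 +
              k * l ^ 2 + ((j + 1 : ℕ) : ℝ) * m ^ 2)) := by gcongr
        _ = ‖v‖ * (l / (l + m) * √((((k + 1 : ℕ) : ℝ) * l - j * m) ^ 2 +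
              ((k + 1 : ℕ) : ℝ) * l ^ 2 + j * m ^ 2) +
            m / (l + m) * √((k * l - ((j + 1 : ℕ) : ℝ) * m) ^ 2 +
              k * l ^ 2 + ((j + 1 : ℕ) : ℝ) * m ^ 2)) := by ring
        _ ≤ _ := by
          refine mul_le_mul_of_nonneg_left ?_ (norm_nonneg v)
          -- The weighted mean of the two radicands is exactly the radicand at (k + 1, j + 1).
          refine (weighted_sqrt_le hl hm (by positivity) (by positivity)).trans (le_of_eq ?_)
          congr 1
          push_cast
          field_simp
          ring

theorem inv_one_sub_pow_le_exp {x : ℝ} (hx1 : x < 1) (n : ℕ) :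
    ((1 - x) ^ n)⁻¹ ≤ Real.exp (n * x / (1 - x)) := by
  have hpos : 0 < 1 - x := by linarith
  have h1 : (1 - x)⁻¹ ≤ Real.exp (x / (1 - x)) := by
    have := Real.add_one_le_exp (x / (1 - x))
    have h2 : x / (1 - x) + 1 = (1 - x)⁻¹ := by field_simp; ring
    linarith
  rw [← inv_pow, mul_div_assoc, Real.exp_nat_mul]
  gcongr

end Banach

/-! ### Convergence of Euler schemes and the semigroup law -/

section ExponentialFormula

variable {X : Type*} [NormedAddCommGroup X] [NormedSpace ℝ X] {A : Set (X × X)} {ω : ℝ}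

theorem eventually_inv_one_sub_pow_le {ι : Type*} {F : Filter ι} {l : ι → ℝ} {k : ι → ℕ}
    {t : ℝ} (hl : Tendsto l F (𝓝 0)) (hk : Tendsto (fun i => k i * l i) F (𝓝 t)) :
    ∀ᶠ i in F, l i * ω < 1 ∧ ((1 - l i * ω) ^ k i)⁻¹ ≤ Real.exp (t * ω + 1) := by
  have h0 : Tendsto (fun i => l i * ω) F (𝓝 0) := by simpa using hl.mul_const ω
  have h1 : Tendsto (fun i => k i * (l i * ω) / (1 - l i * ω)) F (𝓝 (t * ω)) := by
    have := (hk.mul_const ω).div (tendsto_const_nhds.sub h0) (by norm_num : (1 : ℝ) - 0 ≠ 0)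
    simp only [sub_zero, div_one] at this
    exact this.congr fun i => by simp only [Pi.div_apply, mul_assoc]
  filter_upwards [h0.eventually_lt_const (show (0 : ℝ) < 1 by norm_num),
    h1.eventually_lt_const (show t * ω < t * ω + 1 by linarith)] with i hi hi'
  exact ⟨hi, (inv_one_sub_pow_le_exp hi _).trans (Real.exp_le_exp.2 hi'.le)⟩

/-- Replacing x by a nearby y in the domain costs G‖x - y‖ in each scheme; at y Kobayashi's radicand
tends to (t - t)² = 0. Arbitrary steps along a filter are allowed so that one statement gives the
Cauchy property, independence of the step sizes and, through these, the semigroup law. -/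
theorem IsQuasiMAccretive.tendsto_iterate_sub_iterate (hA : IsQuasiMAccretive A ω)
    (hD : Dense (effDomain A)) {ι : Type*} {F : Filter ι} {l m : ι → ℝ} {k j : ι → ℕ} {t : ℝ}
    (hl0 : ∀ᶠ i in F, 0 < l i) (hl : Tendsto l F (𝓝 0))
    (hk : Tendsto (fun i => k i * l i) F (𝓝 t))
    (hm0 : ∀ᶠ i in F, 0 < m i) (hm : Tendsto m F (𝓝 0))
    (hj : Tendsto (fun i => j i * m i) F (𝓝 t)) (x : X) :
    Tendsto (fun i => ‖(resolvent A (l i))^[k i] x - (resolvent A (m i))^[j i] x‖) F (𝓝 0) := by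
  set G := Real.exp (t * ω + 1) with hG
  have hGpos : 0 < G := Real.exp_pos _
  rw [Metric.tendsto_nhds]
  intro ε hε
  obtain ⟨y, ⟨v, hyv⟩, hxy⟩ := hD.exists_dist_lt x (show 0 < ε / (4 * G) by positivity)
  rw [dist_eq_norm] at hxy
  have hsq : Tendsto (fun i => G * G * (‖v‖ * √((k i * l i - j i * m i) ^ 2 + k i * l i ^ 2 +
      j i * m i ^ 2))) F (𝓝 0) := by
    have h1 : Tendsto (fun i => (k i * l i - j i * m i) ^ 2 + (k i * l i) * l i +
        (j i * m i) * m i) F (𝓝 ((t - t) ^ 2 + t * 0 + t * 0)) :=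
      (((hk.sub hj).pow 2).add (hk.mul hl)).add (hj.mul hm)
    have h2 := (((Real.continuous_sqrt.tendsto _).comp h1).const_mul ‖v‖).const_mul (G * G)
    simp only [sub_self, ne_eq, OfNat.ofNat_ne_zero, not_false_eq_true, zero_pow, mul_zero,
      add_zero, Real.sqrt_zero] at h2
    refine h2.congr fun i => ?_
    simp only [Function.comp]
    congr 3
    ring
  filter_upwards [hl0, hm0, eventually_inv_one_sub_pow_le (ω := ω) hl hk,
    eventually_inv_one_sub_pow_le (ω := ω) hm hj,
    hsq.eventually_lt_const (show 0 < ε / 4 by positivity)] with i hli hmi hlG hmG hs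
  obtain ⟨hlω, hlG⟩ := hlG
  obtain ⟨hmω, hmG⟩ := hmG
  have hc : 0 < (1 - l i * ω) ^ k i := pow_pos (by linarith) _
  have hd : 0 < (1 - m i * ω) ^ j i := pow_pos (by linarith) _
  have e1 : ‖(resolvent A (l i))^[k i] x - (resolvent A (l i))^[k i] y‖ ≤ G * ‖x - y‖ := by
    have := hA.norm_iterate_sub_le hli hlω (k i) x y
    rw [← le_inv_mul_iff₀ hc] at this
    exact this.trans (by gcongr)
  have e2 : ‖(resolvent A (m i))^[j i] y - (resolvent A (m i))^[j i] x‖ ≤ G * ‖x - y‖ := by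
    rw [norm_sub_rev]
    have := hA.norm_iterate_sub_le hmi hmω (j i) x y
    rw [← le_inv_mul_iff₀ hd] at this
    exact this.trans (by gcongr)
  have e3 : ‖(resolvent A (l i))^[k i] y - (resolvent A (m i))^[j i] y‖ ≤
      G * G * (‖v‖ * √((k i * l i - j i * m i) ^ 2 + k i * l i ^ 2 + j i * m i ^ 2)) := by
    have := hA.kobayashi hli hlω hmi hmω hyv (k i) (j i)
    rw [← le_inv_mul_iff₀ (mul_pos hc hd), mul_inv] at this
    exact this.trans (by gcongr)
  have e4 : G * ‖x - y‖ ≤ ε / 4 := by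
    have := mul_le_mul_of_nonneg_left hxy.le hGpos.le
    refine this.trans (le_of_eq ?_)
    field_simp
  have e5 : ‖(resolvent A (l i))^[k i] x - (resolvent A (m i))^[j i] x‖ ≤
      ‖(resolvent A (l i))^[k i] x - (resolvent A (l i))^[k i] y‖ +
      ‖(resolvent A (l i))^[k i] y - (resolvent A (m i))^[j i] y‖ +
      ‖(resolvent A (m i))^[j i] y - (resolvent A (m i))^[j i] x‖ := by
    refine le_trans (le_of_eq ?_) (norm_add₃_le)
    congr 1; abel
  rw [dist_zero_right, Real.norm_of_nonneg (norm_nonneg _)]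
  linarith

theorem tendsto_natCast_mul_div {t : ℝ} : Tendsto (fun n : ℕ => (n : ℝ) * (t / n)) atTop (𝓝 t) := by
  refine tendsto_const_nhds.congr' ?_
  filter_upwards [eventually_gt_atTop 0] with n hn
  field_simp

theorem IsQuasiMAccretive.tendsto_expApprox [CompleteSpace X] (hA : IsQuasiMAccretive A ω)
    (hD : Dense (effDomain A)) {t : ℝ} (ht : 0 ≤ t) (x : X) :
    Tendsto (expApprox A t x) atTop (𝓝 (semigroup A t x)) := by
  refine tendsto_nhds_limUnder ?_
  rcases ht.eq_or_lt with rfl | ht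
  · refine ⟨x, tendsto_const_nhds.congr fun n => ?_⟩
    simp only [expApprox, zero_div]
    rw [Function.iterate_fixed (resolvent_zero A x)]
  apply cauchySeq_tendsto_of_complete
  rw [cauchySeq_iff_tendsto_dist_atTop_0]
  simp only [dist_eq_norm, expApprox]
  have hpos : ∀ᶠ n : ℕ in atTop, 0 < t / n := by
    filter_upwards [eventually_gt_atTop 0] with n hn
    have : (0 : ℝ) < n := by exact_mod_cast hn
    positivity
  have hlim : Tendsto (fun n : ℕ => t / (n : ℝ)) atTop (𝓝 0) := tendsto_const_div_atTop_nhds_zero_nat t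
  rw [← prod_atTop_atTop_eq]
  exact hA.tendsto_iterate_sub_iterate hD
    (hpos.prod_inl atTop) (hlim.comp tendsto_fst)
    (tendsto_natCast_mul_div.comp tendsto_fst) (hpos.prod_inr atTop)
    (hlim.comp tendsto_snd) (tendsto_natCast_mul_div.comp tendsto_snd) x

theorem semigroup_zero (x : X) : semigroup A 0 x = x := by
  have : expApprox A 0 x = fun _ => x := by
    funext n
    simp only [expApprox, zero_div]
    rw [Function.iterate_fixed (resolvent_zero A x)]
  rw [semigroup, this]
  exact tendsto_const_nhds.limUnder_eq

theorem IsQuasiMAccretive.tendsto_iterate [CompleteSpace X] (hA : IsQuasiMAccretive A ω)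
    (hD : Dense (effDomain A)) {t : ℝ} (ht : 0 < t) {l : ℕ → ℝ} {k : ℕ → ℕ}
    (hl0 : ∀ᶠ i in atTop, 0 < l i) (hl : Tendsto l atTop (𝓝 0))
    (hk : Tendsto (fun i => k i * l i) atTop (𝓝 t)) (x : X) :
    Tendsto (fun i => (resolvent A (l i))^[k i] x) atTop (𝓝 (semigroup A t x)) := by
  have hpos : ∀ᶠ n : ℕ in atTop, 0 < t / n := by
    filter_upwards [eventually_gt_atTop 0] with n hn
    have : (0 : ℝ) < n := by exact_mod_cast hn
    positivity
  have h1 := hA.tendsto_iterate_sub_iterate hD hl0 hl hk hpos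
    (tendsto_const_div_atTop_nhds_zero_nat t) tendsto_natCast_mul_div x
  have h2 := hA.tendsto_expApprox hD ht.le x
  have h3 := (tendsto_zero_iff_norm_tendsto_zero.2 h1).add h2
  rw [zero_add] at h3
  refine h3.congr fun n => ?_
  simp [expApprox]

/-- With the common step 1/n, performing ⌊sn⌋ and then ⌊tn⌋ steps is literally a scheme of ⌊tn⌋ +
⌊sn⌋ steps, which approximates time t + s. -/
theorem IsQuasiMAccretive.semigroup_add [CompleteSpace X] (hA : IsQuasiMAccretive A ω)
    (hD : Dense (effDomain A)) {t s : ℝ} (ht : 0 ≤ t) (hs : 0 ≤ s) (x : X) :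
    semigroup A (t + s) x = semigroup A t (semigroup A s x) := by
  rcases ht.eq_or_lt with rfl | ht
  · rw [semigroup_zero, zero_add]
  rcases hs.eq_or_lt with rfl | hs
  · rw [semigroup_zero, add_zero]
  set l : ℕ → ℝ := fun n => 1 / (n : ℝ) with hldef
  have hl0 : ∀ᶠ n in atTop, 0 < l n := by
    filter_upwards [eventually_gt_atTop 0] with n hn
    have : (0 : ℝ) < n := by exact_mod_cast hn
    simp only [hldef]; positivity
  have hl : Tendsto l atTop (𝓝 0) := tendsto_const_div_atTop_nhds_zero_nat 1
  have hfl : ∀ t : ℝ, 0 < t → Tendsto (fun n : ℕ => (⌊t * n⌋₊ : ℝ) * l n) atTop (𝓝 t) := by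
    intro t ht
    have := (tendsto_nat_floor_mul_div_atTop ht.le).comp (tendsto_natCast_atTop_atTop (R := ℝ))
    refine this.congr fun n => ?_
    simp [hldef, div_eq_mul_inv]
  have h1 := hA.tendsto_iterate hD hs hl0 hl (hfl s hs) x
  have h2 := hA.tendsto_iterate hD ht hl0 hl (hfl t ht) (semigroup A s x)
  have h3 := hA.tendsto_iterate hD (add_pos ht hs) hl0 hl
    (k := fun n => ⌊t * n⌋₊ + ⌊s * n⌋₊)
    (((hfl t ht).add (hfl s hs)).congr fun n => by push_cast; ring) x
  have h4 : Tendsto (fun n => (resolvent A (l n))^[⌊t * n⌋₊] (semigroup A s x) -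
      (resolvent A (l n))^[⌊t * n⌋₊ + ⌊s * n⌋₊] x) atTop (𝓝 0) := by
    rw [tendsto_zero_iff_norm_tendsto_zero]
    have h5 : Tendsto (fun n => Real.exp (t * ω + 1) *
        ‖semigroup A s x - (resolvent A (l n))^[⌊s * n⌋₊] x‖) atTop (𝓝 0) := by
      have := ((tendsto_const_nhds (x := semigroup A s x)).sub h1).norm.const_mul
        (Real.exp (t * ω + 1))
      simpa using this
    refine squeeze_zero' (Eventually.of_forall fun _ => norm_nonneg _) ?_ h5
    filter_upwards [hl0, eventually_inv_one_sub_pow_le (ω := ω) hl (hfl t ht)] with n hn hG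
    rw [Function.iterate_add_apply]
    have := hA.norm_iterate_sub_le hn hG.1 ⌊t * n⌋₊ (semigroup A s x)
      ((resolvent A (l n))^[⌊s * n⌋₊] x)
    rw [← le_inv_mul_iff₀ (pow_pos (by linarith [hG.1]) _)] at this
    exact this.trans (by gcongr; exact hG.2)
  exact tendsto_nhds_unique h3 (by simpa using h2.sub h4)

theorem IsQuasiMAccretive.norm_semigroup_sub_self_le [CompleteSpace X]
    (hA : IsQuasiMAccretive A ω) (hD : Dense (effDomain A)) {t : ℝ} (ht : 0 < t) {x v : X}
    (hx : (x, v) ∈ A) : ‖semigroup A t x - x‖ ≤ Real.exp (t * ω + 1) * (t * ‖v‖) := by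
  have h1 := ((hA.tendsto_expApprox hD ht.le x).sub_const x).norm
  refine le_of_tendsto h1 ?_
  filter_upwards [eventually_gt_atTop 0, eventually_inv_one_sub_pow_le (ω := ω)
    (tendsto_const_div_atTop_nhds_zero_nat t) tendsto_natCast_mul_div] with n hn hG
  have hn' : (0 : ℝ) < n := by exact_mod_cast hn
  have := hA.norm_iterate_sub_self_le (show 0 < t / n by positivity) hG.1 hx n
  rw [← le_inv_mul_iff₀ (pow_pos (by linarith [hG.1]) _)] at this
  refine this.trans ?_
  rw [mul_div_cancel₀ _ hn'.ne']
  gcongr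
  exact hG.2

theorem IsQuasiMAccretive.semigroup_eq_of_mem [CompleteSpace X] (hA : IsQuasiMAccretive A ω)
    (hD : Dense (effDomain A)) {t : ℝ} (ht : 0 ≤ t) {x : X}
    (hx : (x, (0 : X)) ∈ A) : semigroup A t x = x := by
  rcases ht.eq_or_lt with rfl | ht
  · exact semigroup_zero x
  have := hA.norm_semigroup_sub_self_le hD ht hx
  rw [norm_zero, mul_zero, mul_zero] at this
  exact sub_eq_zero.1 (norm_le_zero_iff.1 this)

end ExponentialFormula

/-! ### Complete accretivity and L^p estimates -/

section Lebesgue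

variable {Ω : Type*} [MeasurableSpace Ω] {μ : Measure Ω} {q : ℝ≥0∞}

theorem isJ0_enorm_rpow {p : ℝ} (hp : 1 ≤ p) : IsJ0 fun x : ℝ => ‖x‖ₑ ^ p := by
  have hp0 : 0 < p := by linarith
  refine ⟨⟨convex_univ, fun x _ y _ a b ha hb hab => ?_⟩, ?_, by simp [hp0]⟩
  · simp only [ENNReal.smul_def, smul_eq_mul]
    refine le_trans ?_ (ENNReal.rpow_arith_mean_le_arith_mean2_rpow _ _ _ _
      (by exact_mod_cast hab) hp)
    refine ENNReal.rpow_le_rpow ?_ hp0.le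
    refine (enorm_add_le _ _).trans (le_of_eq ?_)
    simp [NNReal.smul_def, enorm_mul]
  · exact ((ENNReal.continuous_rpow_const).comp continuous_enorm).lowerSemicontinuous

theorem isJ0_ofReal_abs_sub {M : ℝ} (hM : 0 ≤ M) :
    IsJ0 fun x : ℝ => ENNReal.ofReal (|x| - M) := by
  refine ⟨⟨convex_univ, fun x _ y _ a b ha hb hab => ?_⟩, ?_, by simpa using hM⟩
  · simp only [ENNReal.smul_def, smul_eq_mul, NNReal.smul_def]
    rw [← ENNReal.ofReal_coe_nnreal, ← ENNReal.ofReal_coe_nnreal,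
      ← ENNReal.ofReal_mul a.coe_nonneg, ← ENNReal.ofReal_mul b.coe_nonneg]
    refine le_trans (ENNReal.ofReal_le_ofReal ?_) ENNReal.ofReal_add_le
    have h1 := abs_add_le (a * x : ℝ) (b * y)
    rw [abs_mul, abs_mul, abs_of_nonneg a.coe_nonneg, abs_of_nonneg b.coe_nonneg] at h1
    have h2 : (a : ℝ) + b = 1 := by exact_mod_cast hab
    have h3 : M = a * M + b * M := by rw [← add_mul, h2, one_mul]
    linarith
  · exact (ENNReal.continuous_ofReal.comp (by fun_prop)).lowerSemicontinuous

/-- For finite p the test function is |x|^p. For p = ∞ it is (|x| - M)⁺ with M the essential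
supremum of |g|: its integral along g vanishes, hence also along f. -/
theorem eLpNorm_le_of_forall_isJ0 {f g : Ω → ℝ} (hf : AEStronglyMeasurable f μ)
    (h : ∀ j, IsJ0 j → ∫⁻ x, j (f x) ∂μ ≤ ∫⁻ x, j (g x) ∂μ) {p : ℝ≥0∞} (hp : 1 ≤ p) :
    eLpNorm f p μ ≤ eLpNorm g p μ := by
  rcases eq_or_ne p ∞ with rfl | hp'
  · by_cases hg : eLpNorm g ∞ μ = ∞
    · rw [hg]; exact le_top
    rw [eLpNorm_exponent_top] at hg
    set M := (eLpNormEssSup g μ).toReal with hMdef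
    have hMof : ENNReal.ofReal M = eLpNormEssSup g μ := ENNReal.ofReal_toReal hg
    have h1 := h _ (isJ0_ofReal_abs_sub (M := M) ENNReal.toReal_nonneg)
    have h2 : ∫⁻ x, ENNReal.ofReal (|g x| - M) ∂μ = 0 := by
      rw [← lintegral_zero (μ := μ)]
      refine lintegral_congr_ae ?_
      filter_upwards [ae_le_eLpNormEssSup (f := g) (μ := μ)] with x hx
      rw [ENNReal.ofReal_eq_zero, sub_nonpos]
      rw [← hMof, Real.enorm_eq_ofReal_abs] at hx
      exact (ENNReal.ofReal_le_ofReal_iff ENNReal.toReal_nonneg).1 hx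
    rw [h2, nonpos_iff_eq_zero, lintegral_eq_zero_iff'] at h1
    · rw [eLpNorm_exponent_top, eLpNorm_exponent_top, ← hMof]
      refine eLpNormEssSup_le_of_ae_enorm_bound ?_
      filter_upwards [h1] with x hx
      have : |f x| - M ≤ 0 := ENNReal.ofReal_eq_zero.1 hx
      rw [Real.enorm_eq_ofReal_abs]
      exact ENNReal.ofReal_le_ofReal (by linarith)
    · have := hf.aemeasurable
      exact (ENNReal.measurable_ofReal.comp_aemeasurable
        ((continuous_abs.measurable.comp_aemeasurable this).sub_const M))
  · have hp0 : p ≠ 0 := (zero_lt_one.trans_le hp).ne'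
    rw [eLpNorm_eq_lintegral_rpow_enorm_toReal hp0 hp',
      eLpNorm_eq_lintegral_rpow_enorm_toReal hp0 hp']
    refine ENNReal.rpow_le_rpow ?_ (by positivity)
    exact h _ (isJ0_enorm_rpow (by simpa using ENNReal.toReal_mono hp' hp))

theorem eLpNorm_coe_smul (c : ℝ) (f : Lp ℝ q μ) (p : ℝ≥0∞) :
    eLpNorm (c • f : Lp ℝ q μ) p μ = ‖c‖ₑ * eLpNorm f p μ := by
  rw [eLpNorm_congr_ae (Lp.coeFn_smul c f), eLpNorm_const_smul]

theorem eLpNorm_coe_add_le (f g : Lp ℝ q μ) {p : ℝ≥0∞} (hp : 1 ≤ p) :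
    eLpNorm (f + g : Lp ℝ q μ) p μ ≤ eLpNorm f p μ + eLpNorm g p μ := by
  rw [eLpNorm_congr_ae (Lp.coeFn_add f g)]
  exact eLpNorm_add_le (Lp.aestronglyMeasurable f) (Lp.aestronglyMeasurable g) hp

/-- The `L^p` norm is lower semicontinuous with respect to convergence in `L^q`. -/
theorem eLpNorm_le_of_tendsto_Lp [Fact (1 ≤ q)] {f : ℕ → Lp ℝ q μ} {g : Lp ℝ q μ}
    (hfg : Tendsto f atTop (𝓝 g)) {p : ℝ≥0∞} {c : ℕ → ℝ≥0∞} {C : ℝ≥0∞}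
    (hc : ∀ᶠ n in atTop, eLpNorm (f n) p μ ≤ c n) (hC : Tendsto c atTop (𝓝 C)) :
    eLpNorm g p μ ≤ C := by
  -- Almost everywhere convergence holds only along a subsequence; Fatou along it suffices because
  -- `c` converges.
  obtain ⟨ns, hns, hlim⟩ := (tendstoInMeasure_of_tendsto_Lp hfg).exists_seq_tendsto_ae
  refine (Lp.eLpNorm_lim_le_liminf_eLpNorm (f := fun n => f (ns n))
    (fun n => Lp.aestronglyMeasurable _) g hlim).trans ?_
  rw [← (hC.comp hns.tendsto_atTop).liminf_eq]
  exact liminf_le_liminf (hns.tendsto_atTop.eventually hc)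

/-- The step h / (1 - hω) for A + ωI corresponds to the step h for A, and the rescaling of the data
produces the factor (1 - hω)⁻¹. -/
theorem IsCompletelyAccretive.eLpNorm_sub_le {A : Set (Lp ℝ q μ × Lp ℝ q μ)} {ω : ℝ}
    (hA : IsCompletelyAccretive (addScalarId A ω)) {h : ℝ} (hh : 0 < h) (hω : h * ω < 1)
    {u v u' v' : Lp ℝ q μ} (huv : (u, v) ∈ A) (huv' : (u', v') ∈ A) {p : ℝ≥0∞} (hp : 1 ≤ p) :
    eLpNorm (u - u' : Lp ℝ q μ) p μ ≤ ENNReal.ofReal (1 - h * ω)⁻¹ *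
      eLpNorm ((u + h • v) - (u' + h • v') : Lp ℝ q μ) p μ := by
  have hpos : 0 < 1 - h * ω := by linarith
  have h1 := eLpNorm_le_of_forall_isJ0 (Lp.aestronglyMeasurable _)
    (fun j hj => hA (h / (1 - h * ω)) (div_pos hh hpos) j hj u (v + ω • u) u' (v' + ω • u')
      ⟨v, huv, rfl⟩ ⟨v', huv', rfl⟩) hp
  have h2 : (u + (h / (1 - h * ω)) • (v + ω • u)) - (u' + (h / (1 - h * ω)) • (v' + ω • u')) =
      (1 - h * ω)⁻¹ • ((u + h • v) - (u' + h • v')) := by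
    have e1 : h / (1 - h * ω) = (1 - h * ω)⁻¹ * h := by ring
    have e2 : (1 - h * ω)⁻¹ = 1 + (1 - h * ω)⁻¹ * h * ω := by field_simp; ring
    have e3 : (1 - h * ω)⁻¹ • ((u + h • v) - (u' + h • v')) =
      (1 - h * ω)⁻¹ • (u - u') + ((1 - h * ω)⁻¹ * h) • (v - v') := by module
    rw [e3, e1]
    nth_rewrite 3 [e2]
    module
  rw [h2, eLpNorm_coe_smul, Real.enorm_of_nonneg (inv_pos.2 hpos).le] at h1
  exact h1

theorem IsMCompletelyAccretive.isQuasiMAccretive [Fact (1 ≤ q)]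
    {A : Set (Lp ℝ q μ × Lp ℝ q μ)} {ω : ℝ} (hω : 0 ≤ ω)
    (hA : IsMCompletelyAccretive (addScalarId A ω)) : IsQuasiMAccretive A ω := by
  have key : ∀ (B : Set (Lp ℝ q μ × Lp ℝ q μ)) (ω : ℝ),
      IsCompletelyAccretive (addScalarId B ω) → IsQuasiAccretive B ω := by
    intro B ω hB h hh hhω u v u' v' huv huv'
    have hpos : 0 < 1 - h * ω := by linarith
    have := hB.eLpNorm_sub_le hh hhω huv huv' (Fact.out : 1 ≤ q)
    rw [Lp.norm_def, Lp.norm_def, ← le_inv_mul_iff₀ hpos]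
    have h2 := ENNReal.toReal_mono
      (ENNReal.mul_ne_top ENNReal.ofReal_ne_top (Lp.eLpNorm_ne_top _)) this
    rwa [ENNReal.toReal_mul, ENNReal.toReal_ofReal (inv_pos.2 hpos).le] at h2
  refine IsQuasiMAccretive.of_addScalarId hω (key A ω hA.1) (key _ 0 ?_) hA.2
  have : addScalarId (addScalarId A ω) 0 = addScalarId A ω := by
    ext p
    simp [addScalarId]
  rw [this]; exact hA.1

variable [Fact (1 ≤ q)] {A : Set (Lp ℝ q μ × Lp ℝ q μ)} {ω : ℝ}

theorem IsMCompletelyAccretive.eLpNorm_iterate_sub_le (hω : 0 ≤ ω)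
    (hA : IsMCompletelyAccretive (addScalarId A ω)) {h : ℝ} (hh : 0 < h) (hhω : h * ω < 1)
    {p : ℝ≥0∞} (hp : 1 ≤ p) (n : ℕ) (u u' : Lp ℝ q μ) :
    eLpNorm ((resolvent A h)^[n] u - (resolvent A h)^[n] u' : Lp ℝ q μ) p μ ≤
      ENNReal.ofReal ((1 - h * ω)⁻¹ ^ n) * eLpNorm (u - u' : Lp ℝ q μ) p μ := by
  have hpos : 0 < 1 - h * ω := by linarith
  have hQ := hA.isQuasiMAccretive hω
  induction n with
  | zero => simp
  | succ n ih =>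
    rw [Function.iterate_succ_apply', Function.iterate_succ_apply', pow_succ',
      ENNReal.ofReal_mul (inv_pos.2 hpos).le, mul_assoc]
    obtain ⟨v, hv, hf⟩ := hQ.resolvent_spec hh hhω ((resolvent A h)^[n] u)
    obtain ⟨w, hw, hg⟩ := hQ.resolvent_spec hh hhω ((resolvent A h)^[n] u')
    have h1 := hA.1.eLpNorm_sub_le hh hhω hv hw hp
    rw [hf, hg] at h1
    refine h1.trans ?_
    gcongr

theorem tendsto_exp_bound (t ω : ℝ) :
    Tendsto (fun n : ℕ => Real.exp (n * (t / n * ω) / (1 - t / n * ω))) atTop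
      (𝓝 (Real.exp (ω * t))) := by
  have h0 : Tendsto (fun n : ℕ => t / n * ω) atTop (𝓝 0) := by
    simpa using (tendsto_const_div_atTop_nhds_zero_nat t).mul_const ω
  have h1 := ((tendsto_natCast_mul_div (t := t)).mul_const ω).div
    (tendsto_const_nhds.sub h0) (by norm_num : (1 : ℝ) - 0 ≠ 0)
  simp only [sub_zero, div_one] at h1
  rw [mul_comm ω t]
  refine (Real.continuous_exp.tendsto _).comp (h1.congr fun n => ?_)
  simp only [Pi.div_apply, mul_assoc]

theorem eventually_div_mul_lt_one (t ω : ℝ) : ∀ᶠ n : ℕ in atTop, 0 < n ∧ t / n * ω < 1 := by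
  have h0 : Tendsto (fun n : ℕ => t / n * ω) atTop (𝓝 0) := by
    simpa using (tendsto_const_div_atTop_nhds_zero_nat t).mul_const ω
  filter_upwards [eventually_gt_atTop 0, h0.eventually_lt_const one_pos] with n h1 h2
  exact ⟨h1, h2⟩

theorem IsMCompletelyAccretive.eLpNorm_semigroup_sub_le (hω : 0 ≤ ω)
    (hA : IsMCompletelyAccretive (addScalarId A ω)) (hD : Dense (effDomain A)) {t : ℝ}
    (ht : 0 ≤ t) {p : ℝ≥0∞} (hp : 1 ≤ p) (u u' : Lp ℝ q μ) :
    eLpNorm (semigroup A t u - semigroup A t u' : Lp ℝ q μ) p μ ≤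
      ENNReal.ofReal (Real.exp (ω * t)) * eLpNorm (u - u' : Lp ℝ q μ) p μ := by
  have hQ := hA.isQuasiMAccretive hω
  rcases ht.eq_or_lt with rfl | ht
  · simp [semigroup_zero]
  refine eLpNorm_le_of_tendsto_Lp
    ((hQ.tendsto_expApprox hD ht.le u).sub (hQ.tendsto_expApprox hD ht.le u'))
    (c := fun n : ℕ => ENNReal.ofReal (Real.exp (n * (t / n * ω) / (1 - t / n * ω))) *
      eLpNorm (u - u' : Lp ℝ q μ) p μ) ?_
    (ENNReal.Tendsto.mul_const
      ((ENNReal.continuous_ofReal.tendsto _).comp (tendsto_exp_bound t ω))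
      (Or.inl (by simp [Real.exp_pos])))
  filter_upwards [eventually_div_mul_lt_one t ω] with n hn
  have hn' : (0 : ℝ) < n := by exact_mod_cast hn.1
  refine (hA.eLpNorm_iterate_sub_le hω (div_pos ht hn') hn.2 hp n u u').trans ?_
  gcongr
  rw [inv_pow]
  exact inv_one_sub_pow_le_exp hn.2 n

end Lebesgue

/-! ### The L^q-L^r estimate -/

section GagliardoNirenberg

/-- The graph of the convex function x^p lies above its tangent at y. For y > 0 this is Bernoulli's
inequality by homogeneity. -/
theorem mul_rpow_mul_sub_le_rpow_sub_rpow {x y p : ℝ} (hx : 0 ≤ x) (hy : 0 ≤ y) (hp : 1 ≤ p) :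
    p * y ^ (p - 1) * (x - y) ≤ x ^ p - y ^ p := by
  rcases hy.eq_or_lt with rfl | hy
  · rcases hp.eq_or_lt with rfl | hp
    · simp
    · rw [Real.zero_rpow (by linarith), Real.zero_rpow (by linarith)]
      simpa using Real.rpow_nonneg hx p
  · have h1 := one_add_mul_self_le_rpow_one_add (s := x / y - 1) (p := p)
      (by linarith [div_nonneg hx hy.le]) hp
    have h2 : (1 + (x / y - 1)) ^ p = x ^ p / y ^ p := by
      rw [← Real.div_rpow hx hy.le]; congr 1; ring
    have h3 : y ^ (p - 1) = y ^ p / y := Real.rpow_sub_one hy.ne' p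
    have h4 : 0 < y ^ p := Real.rpow_pos_of_pos hy p
    rw [h2, le_div_iff₀ h4] at h1
    rw [h3]
    have h5 : p * (y ^ p / y) * (x - y) = p * (x / y - 1) * y ^ p := by field_simp
    rw [h5]
    linarith

variable {Ω : Type*} [MeasurableSpace Ω] {μ : Measure Ω} {q : ℝ≥0∞} [Fact (1 ≤ q)]

theorem qBracket_le (hq : q ≠ ∞) (u v : Lp ℝ q μ) {h : ℝ} (hh : 0 < h) :
    qBracket u v ≤
      (q.toReal⁻¹ * ‖u + h • v‖ ^ q.toReal - q.toReal⁻¹ * ‖u‖ ^ q.toReal) / h := by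
  have hQ : 1 ≤ q.toReal := by simpa using ENNReal.toReal_mono hq (Fact.out : 1 ≤ q)
  have hQ0 : 0 < q.toReal := by linarith
  -- The real infimum is below its members only if the family is bounded below (otherwise it
  -- defaults to 0); the tangent inequality supplies the bound.
  refine ciInf_le ⟨-(‖u‖ ^ (q.toReal - 1) * ‖v‖), ?_⟩ (⟨h, hh⟩ : Set.Ioi (0 : ℝ))
  rintro _ ⟨⟨l, hl⟩, rfl⟩
  have hl0 : 0 < l := hl
  simp only
  rw [le_div_iff₀ hl0, ← mul_sub, ← div_eq_inv_mul, le_div_iff₀ hQ0]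
  refine le_trans ?_ (mul_rpow_mul_sub_le_rpow_sub_rpow (norm_nonneg (u + l • v))
    (norm_nonneg u) hQ)
  have h1 : -(l * ‖v‖) ≤ ‖u + l • v‖ - ‖u‖ := by
    have := norm_sub_le (u + l • v) (l • v)
    rw [add_sub_cancel_right, norm_smul, Real.norm_of_nonneg hl0.le] at this
    linarith
  have h2 : 0 ≤ q.toReal * ‖u‖ ^ (q.toReal - 1) := by positivity
  have := mul_le_mul_of_nonneg_left h1 h2
  linarith

/-- A discrete Gronwall estimate for the telescoping sums of an implicit Euler scheme. -/
theorem sum_rpow_sub_rpow_add_le {Q a N : ℝ} (hQ : 1 ≤ Q) (ha : 1 ≤ a) (hN : 0 ≤ N)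
    {x : ℕ → ℝ} (hx : ∀ k, 0 ≤ x k) (hxa : ∀ k, x k ≤ a ^ k * N) (n : ℕ) :
    ∑ k ∈ Finset.range n, ((x k ^ Q - x (k + 1) ^ Q) / Q + (1 - a⁻¹) * x (k + 1) ^ Q) ≤
      N ^ Q / Q * (a ^ (Q - 1) * (a ^ n) ^ Q) := by
  have hQ0 : 0 < Q := by linarith
  have ha0 : 0 < a := by linarith
  -- The induction needs the boundary term x_n^Q / Q on the left and a right-hand side whose
  -- increments dominate (1 - a⁻¹) x_{n+1}^Q; the latter follows from Q(a - 1) ≤ a^Q - 1.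
  suffices h : ∑ k ∈ Finset.range n,
      ((x k ^ Q - x (k + 1) ^ Q) / Q + (1 - a⁻¹) * x (k + 1) ^ Q) + x n ^ Q / Q ≤
      N ^ Q / Q * (1 + a ^ (Q - 1) * ((a ^ n) ^ Q - 1)) by
    have h1 : 0 ≤ x n ^ Q / Q := by have := hx n; positivity
    have h2 : 1 ≤ a ^ (Q - 1) := Real.one_le_rpow ha (by linarith)
    have h3 : 0 ≤ N ^ Q / Q := by positivity
    have h4 := mul_le_mul_of_nonneg_left
      (show 1 + a ^ (Q - 1) * ((a ^ n) ^ Q - 1) ≤ a ^ (Q - 1) * (a ^ n) ^ Q by linarith) h3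
    linarith
  induction n with
  | zero =>
    have := Real.rpow_le_rpow (hx 0) (hxa 0) hQ0.le
    simp only [pow_zero, one_mul] at this
    simp only [Finset.range_zero, Finset.sum_empty, pow_zero, Real.one_rpow, sub_self, mul_zero,
      add_zero, mul_one, zero_add]
    gcongr
  | succ n ih =>
    rw [Finset.sum_range_succ]
    have h1 : x (n + 1) ^ Q ≤ (a ^ (n + 1)) ^ Q * N ^ Q := by
      rw [← Real.mul_rpow (by positivity) hN]
      exact Real.rpow_le_rpow (hx _) (hxa _) hQ0.le
    have hpw : (a ^ (n + 1)) ^ Q = (a ^ n) ^ Q * a ^ Q := by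
      rw [pow_succ, Real.mul_rpow (by positivity) ha0.le]
    have h2 : Q * (a - 1) ≤ a ^ Q - 1 := by
      have := mul_rpow_mul_sub_le_rpow_sub_rpow ha0.le zero_le_one hQ
      simpa using this
    have h3 : a ^ Q = a ^ (Q - 1) * a := by
      rw [Real.rpow_sub_one ha0.ne']; field_simp
    have h4 : 0 ≤ 1 - a⁻¹ := by
      have := inv_le_one_of_one_le₀ ha
      linarith
    have h5 : (1 - a⁻¹) * x (n + 1) ^ Q ≤
        N ^ Q / Q * (a ^ (Q - 1) * ((a ^ (n + 1)) ^ Q - (a ^ n) ^ Q)) := by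
      have e1 : (1 - a⁻¹) * ((a ^ (n + 1)) ^ Q * N ^ Q) =
          N ^ Q / Q * (a ^ (Q - 1) * (a ^ n) ^ Q) * (Q * (a - 1)) := by
        rw [hpw, h3]; field_simp
      have e2 : N ^ Q / Q * (a ^ (Q - 1) * ((a ^ (n + 1)) ^ Q - (a ^ n) ^ Q)) =
          N ^ Q / Q * (a ^ (Q - 1) * (a ^ n) ^ Q) * (a ^ Q - 1) := by rw [hpw]; ring
      rw [e2]
      refine (mul_le_mul_of_nonneg_left h1 h4).trans ?_
      rw [e1]
      gcongr
    have h6 : (x n ^ Q - x (n + 1) ^ Q) / Q = x n ^ Q / Q - x (n + 1) ^ Q / Q := sub_div _ _ _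
    rw [h6]
    linarith

variable {A : Set (Lp ℝ q μ × Lp ℝ q μ)} {ω : ℝ}

/-- The infimum in the q-bracket, taken at the step h itself, gives a backward difference that
telescopes. The L^r Lipschitz bound lets the last norm replace each earlier one. With a = (1 -
hω)⁻¹, the surplus factor a^((q-1)/σ) tends to 1 as h → 0. -/
theorem eLpNorm_iterate_sub_le_of_gagliardoNirenberg (hq : q ≠ ∞) {r : ℝ≥0∞} (hr : 1 ≤ r)
    {ρ σ C : ℝ} (hρ : 0 ≤ ρ) (hσ : 0 < σ) (hC : 0 < C) (hω : 0 ≤ ω)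
    (hA : IsMCompletelyAccretive (addScalarId A ω)) (hGN : GagliardoNirenberg A r ρ σ ω C)
    {h : ℝ} (hh : 0 < h) (hhω : h * ω < 1) {n : ℕ} (hn : 0 < n) (u u' : Lp ℝ q μ) :
    eLpNorm ((resolvent A h)^[n] u - (resolvent A h)^[n] u' : Lp ℝ q μ) r μ ≤
      ENNReal.ofReal ((C / q.toReal) ^ (1 / σ) * (n * h) ^ (-(1 / σ)) *
        (((1 - h * ω)⁻¹ ^ n) ^ ((q.toReal + ρ) / σ + 1) *
          ((1 - h * ω)⁻¹) ^ ((q.toReal - 1) / σ)) * ‖u - u'‖ ^ ((q.toReal + ρ) / σ)) := by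
  set Q := q.toReal with hQdef
  have hQ : 1 ≤ Q := by simpa using ENNReal.toReal_mono hq (Fact.out : 1 ≤ q)
  have hQ0 : 0 < Q := by linarith
  have hM := hA.isQuasiMAccretive hω
  have hpos : 0 < 1 - h * ω := by linarith
  set a := (1 - h * ω)⁻¹ with ha
  have ha1 : 1 ≤ a := (one_le_inv₀ hpos).2 (by nlinarith)
  have ha0 : 0 < a := by linarith
  have hainv : 1 - a⁻¹ = h * ω := by rw [ha, inv_inv]; ring
  set N := ‖u - u'‖ with hN
  set w : ℕ → Lp ℝ q μ := fun k => (resolvent A h)^[k] u - (resolvent A h)^[k] u' with hw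
  have hwk : ∀ k, ‖w k‖ ≤ a ^ k * N := by
    intro k
    have := hM.norm_iterate_sub_le hh hhω k u u'
    rw [← le_inv_mul_iff₀ (pow_pos hpos k), ← inv_pow] at this
    exact this
  have hfin : ∀ k, eLpNorm (w (k + 1)) r μ ≠ ∞ ∧
      h * (eLpNorm (w (k + 1)) r μ).toReal ^ σ ≤ C * ((‖w k‖ ^ Q - ‖w (k + 1)‖ ^ Q) / Q +
        (1 - a⁻¹) * ‖w (k + 1)‖ ^ Q) * ‖w (k + 1)‖ ^ ρ ∧
      0 ≤ (‖w k‖ ^ Q - ‖w (k + 1)‖ ^ Q) / Q + (1 - a⁻¹) * ‖w (k + 1)‖ ^ Q := by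
    intro k
    obtain ⟨v, hv, hf⟩ := hM.resolvent_spec hh hhω ((resolvent A h)^[k] u)
    obtain ⟨v', hv', hf'⟩ := hM.resolvent_spec hh hhω ((resolvent A h)^[k] u')
    rw [← Function.iterate_succ_apply' (resolvent A h) k u] at hv hf
    rw [← Function.iterate_succ_apply' (resolvent A h) k u'] at hv' hf'
    obtain ⟨h1, h2⟩ := hGN _ _ _ _ hv hv'
    have hwz : w (k + 1) + h • (v - v') = w k := by
      simp only [hw]
      rw [← hf, ← hf']; module
    have h3 := qBracket_le hq (w (k + 1)) (v - v') hh
    rw [hwz] at h3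
    refine ⟨h1.eLpNorm_ne_top, ?_, ?_⟩
    · have h4 : 0 ≤ ‖w (k + 1)‖ ^ ρ := by positivity
      have h5 : h * (qBracket (w (k + 1)) (v - v') + ω * ‖w (k + 1)‖ ^ Q) ≤
          (‖w k‖ ^ Q - ‖w (k + 1)‖ ^ Q) / Q + (1 - a⁻¹) * ‖w (k + 1)‖ ^ Q := by
        rw [le_div_iff₀ hh] at h3
        rw [hainv]
        have : (‖w k‖ ^ Q - ‖w (k + 1)‖ ^ Q) / Q = Q⁻¹ * ‖w k‖ ^ Q - Q⁻¹ * ‖w (k + 1)‖ ^ Q := by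
          ring
        linarith
      calc h * (eLpNorm (w (k + 1)) r μ).toReal ^ σ
          ≤ h * (C * (qBracket (w (k + 1)) (v - v') + ω * ‖w (k + 1)‖ ^ Q) * ‖w (k + 1)‖ ^ ρ) :=
            mul_le_mul_of_nonneg_left h2 hh.le
        _ = C * (h * (qBracket (w (k + 1)) (v - v') + ω * ‖w (k + 1)‖ ^ Q)) *
            ‖w (k + 1)‖ ^ ρ := by ring
        _ ≤ _ := by gcongr
    -- Accretivity and the tangent inequality make the bracketed term nonnegative, so ‖w (k + 1)‖^ρ
    -- may later be enlarged to a bound independent of k.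
    · have h6 := hM.accretive h hh hhω _ _ _ _ hv hv'
      rw [hf, hf'] at h6
      change (1 - h * ω) * ‖w (k + 1)‖ ≤ ‖w k‖ at h6
      have h7 := mul_rpow_mul_sub_le_rpow_sub_rpow (norm_nonneg (w k)) (norm_nonneg (w (k + 1))) hQ
      have h8 : ‖w (k + 1)‖ ^ (Q - 1) * ‖w (k + 1)‖ = ‖w (k + 1)‖ ^ Q := by
        rcases (norm_nonneg (w (k + 1))).eq_or_lt with h0 | h0
        · rw [← h0, Real.zero_rpow hQ0.ne', mul_zero]
        · rw [Real.rpow_sub_one h0.ne']; field_simp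
      have h9 : -(Q * (h * ω) * ‖w (k + 1)‖ ^ Q) ≤ ‖w k‖ ^ Q - ‖w (k + 1)‖ ^ Q := by
        refine le_trans ?_ h7
        rw [← h8]
        have : 0 ≤ Q * ‖w (k + 1)‖ ^ (Q - 1) := by positivity
        nlinarith [mul_le_mul_of_nonneg_left h6 this]
      rw [hainv, ← neg_le_iff_add_nonneg, le_div_iff₀ hQ0]
      linarith
  set R := (eLpNorm (w n) r μ).toReal with hR
  have hR0 : 0 ≤ R := ENNReal.toReal_nonneg
  have hRk : ∀ k < n, R ≤ a ^ n * (eLpNorm (w (k + 1)) r μ).toReal := by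
    intro k hk
    have h1 := hA.eLpNorm_iterate_sub_le hω hh hhω hr (n - (k + 1))
      ((resolvent A h)^[k + 1] u) ((resolvent A h)^[k + 1] u')
    rw [← Function.iterate_add_apply, ← Function.iterate_add_apply,
      Nat.sub_add_cancel (by omega)] at h1
    have h2 := ENNReal.toReal_mono (ENNReal.mul_ne_top ENNReal.ofReal_ne_top (hfin k).1) h1
    rw [ENNReal.toReal_mul, ENNReal.toReal_ofReal (by positivity)] at h2
    refine h2.trans ?_
    gcongr
    omega
  have hsum : n * h * R ^ σ ≤ (a ^ n) ^ σ * (C * (N ^ Q / Q * (a ^ (Q - 1) * (a ^ n) ^ Q)) *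
      (a ^ n * N) ^ ρ) := by
    have h1 := sum_rpow_sub_rpow_add_le hQ ha1 (norm_nonneg (u - u'))
      (fun k => norm_nonneg (w k)) hwk n
    calc n * h * R ^ σ = ∑ k ∈ Finset.range n, h * R ^ σ := by simp; ring
      _ ≤ ∑ k ∈ Finset.range n, (a ^ n) ^ σ * (C * ((‖w k‖ ^ Q - ‖w (k + 1)‖ ^ Q) / Q +
        (1 - a⁻¹) * ‖w (k + 1)‖ ^ Q) * (a ^ n * N) ^ ρ) := by
          refine Finset.sum_le_sum fun k hk => ?_
          rw [Finset.mem_range] at hk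
          have h2 := Real.rpow_le_rpow hR0 (hRk k hk) hσ.le
          rw [Real.mul_rpow (by positivity) ENNReal.toReal_nonneg] at h2
          calc h * R ^ σ ≤ h * ((a ^ n) ^ σ * (eLpNorm (w (k + 1)) r μ).toReal ^ σ) := by gcongr
            _ = (a ^ n) ^ σ * (h * (eLpNorm (w (k + 1)) r μ).toReal ^ σ) := by ring
            _ ≤ (a ^ n) ^ σ * _ := mul_le_mul_of_nonneg_left (hfin k).2.1 (by positivity)
            _ ≤ _ := by
              have h3 := (hfin k).2.2
              have h4 : ‖w (k + 1)‖ ≤ a ^ n * N := by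
                refine (hwk _).trans ?_
                gcongr
                omega
              gcongr
      _ = (a ^ n) ^ σ * (C * (∑ k ∈ Finset.range n, ((‖w k‖ ^ Q - ‖w (k + 1)‖ ^ Q) / Q +
        (1 - a⁻¹) * ‖w (k + 1)‖ ^ Q)) * (a ^ n * N) ^ ρ) := by
          rw [← Finset.mul_sum, ← Finset.sum_mul, ← Finset.mul_sum]
      _ ≤ _ := by gcongr
  have hn' : (0 : ℝ) < n := by exact_mod_cast hn
  have ht : 0 < n * h := by positivity
  obtain ⟨m, rfl⟩ : ∃ m, n = m + 1 := ⟨n - 1, by omega⟩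
  rw [← ENNReal.ofReal_toReal (hfin m).1]
  refine ENNReal.ofReal_le_ofReal ?_
  change R ≤ _
  have hN0 : 0 ≤ N := norm_nonneg _
  set b := a ^ (m + 1) with hb
  have hb0 : 0 < b := by positivity
  have h1 : R ^ σ ≤ (C / Q) * (((m + 1 : ℕ) : ℝ) * h)⁻¹ * ((b ^ (Q + ρ + σ)) * a ^ (Q - 1)) *
      N ^ (Q + ρ) := by
    rw [← le_inv_mul_iff₀ ht] at hsum
    refine hsum.trans (le_of_eq ?_)
    rw [Real.mul_rpow hb0.le hN0, Real.rpow_add hb0, Real.rpow_add hb0,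
      Real.rpow_add_of_nonneg hN0 hQ0.le hρ]
    ring
  have h2 := Real.rpow_le_rpow (by positivity) h1 (show 0 ≤ 1 / σ by positivity)
  rw [← Real.rpow_mul hR0, mul_one_div_cancel hσ.ne', Real.rpow_one] at h2
  refine h2.trans (le_of_eq ?_)
  rw [Real.mul_rpow (by positivity) (by positivity), Real.mul_rpow (by positivity) (by positivity),
    Real.mul_rpow (by positivity) (by positivity), Real.mul_rpow (by positivity) (by positivity),
    ← Real.rpow_mul hb0.le, ← Real.rpow_mul ha0.le, ← Real.rpow_mul hN0,
    Real.rpow_neg ht.le, Real.inv_rpow ht.le]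
  have e1 : (Q + ρ + σ) * (1 / σ) = (Q + ρ) / σ + 1 := by field_simp
  rw [e1, mul_one_div, mul_one_div]

/-- The `L^q`-`L^r` regularization estimate. -/
theorem eLpNorm_semigroup_sub_le_of_gagliardoNirenberg (hq : q ≠ ∞) {r : ℝ≥0∞} (hr : 1 ≤ r)
    {ρ σ C : ℝ} (hρ : 0 ≤ ρ) (hσ : 0 < σ) (hC : 0 < C) (hω : 0 ≤ ω)
    (hA : IsMCompletelyAccretive (addScalarId A ω)) (hD : Dense (effDomain A))
    (hGN : GagliardoNirenberg A r ρ σ ω C) {t : ℝ} (ht : 0 < t) (u u' : Lp ℝ q μ) :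
    eLpNorm (semigroup A t u - semigroup A t u' : Lp ℝ q μ) r μ ≤
      ENNReal.ofReal ((C / q.toReal) ^ (1 / σ) * t ^ (-(1 / σ)) *
        Real.exp (ω * ((q.toReal + ρ) / σ + 1) * t) * ‖u - u'‖ ^ ((q.toReal + ρ) / σ)) := by
  have hM := hA.isQuasiMAccretive hω
  have hQ : 1 ≤ q.toReal := by simpa using ENNReal.toReal_mono hq (Fact.out : 1 ≤ q)
  have hγ : 0 ≤ (q.toReal + ρ) / σ + 1 := by positivity
  have h0 : Tendsto (fun n : ℕ => (1 - t / n * ω)⁻¹) atTop (𝓝 1) := by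
    have : Tendsto (fun n : ℕ => 1 - t / n * ω) atTop (𝓝 1) := by
      simpa using tendsto_const_nhds.sub
        ((tendsto_const_div_atTop_nhds_zero_nat t).mul_const ω)
    simpa using this.inv₀ one_ne_zero
  have hlim : Tendsto (fun n : ℕ => (C / q.toReal) ^ (1 / σ) * t ^ (-(1 / σ)) *
      (Real.exp (n * (t / n * ω) / (1 - t / n * ω)) ^ ((q.toReal + ρ) / σ + 1) *
        ((1 - t / n * ω)⁻¹) ^ ((q.toReal - 1) / σ)) * ‖u - u'‖ ^ ((q.toReal + ρ) / σ)) atTop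
      (𝓝 ((C / q.toReal) ^ (1 / σ) * t ^ (-(1 / σ)) *
        (Real.exp (ω * t) ^ ((q.toReal + ρ) / σ + 1) * 1 ^ ((q.toReal - 1) / σ)) *
          ‖u - u'‖ ^ ((q.toReal + ρ) / σ))) :=
    ((((tendsto_exp_bound t ω).rpow_const (Or.inr hγ)).mul
      (h0.rpow_const (Or.inl one_ne_zero))).const_mul _).mul_const _
  rw [Real.one_rpow, mul_one, ← Real.exp_mul, show ω * t * ((q.toReal + ρ) / σ + 1) =
    ω * ((q.toReal + ρ) / σ + 1) * t by ring] at hlim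
  refine eLpNorm_le_of_tendsto_Lp
    ((hM.tendsto_expApprox hD ht.le u).sub (hM.tendsto_expApprox hD ht.le u')) ?_
    ((ENNReal.continuous_ofReal.tendsto _).comp hlim)
  filter_upwards [eventually_div_mul_lt_one t ω] with n hn
  have hn' : (0 : ℝ) < n := by exact_mod_cast hn.1
  refine (eLpNorm_iterate_sub_le_of_gagliardoNirenberg hq hr hρ hσ hC hω hA hGN
    (div_pos ht hn') hn.2 hn.1 u u').trans ?_
  simp only [Function.comp]
  refine ENNReal.ofReal_le_ofReal ?_
  have hpos : 0 < 1 - t / n * ω := by linarith [hn.2]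
  rw [mul_div_cancel₀ _ hn'.ne']
  gcongr
  rw [inv_pow]
  exact (inv_one_sub_pow_le_exp hn.2 n).trans_eq (by rw [mul_div_assoc])

end GagliardoNirenberg

/-! ### The degenerate case γ > 1 -/

section SuperlinearHolder

variable {Ω : Type*} [MeasurableSpace Ω] {μ : Measure Ω} {q : ℝ≥0∞}

/-- A map which is Hölder continuous with an exponent larger than one is constant. -/
theorem eq_of_eLpNorm_sub_le_rpow {X : Type*} [NormedAddCommGroup X] [NormedSpace ℝ X]
    {F : X → Lp ℝ q μ} {r : ℝ≥0∞} (hr : 1 ≤ r) {c γ : ℝ} (hc : 0 ≤ c) (hγ : 1 < γ)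
    (hF : ∀ u u', eLpNorm (F u - F u' : Lp ℝ q μ) r μ ≤ ENNReal.ofReal (c * ‖u - u'‖ ^ γ))
    (u u' : X) : F u = F u' := by
  -- Cutting the segment from u to u' into N equal pieces costs N · N^(-γ), which tends to 0.
  have key : ∀ N : ℕ, 0 < N → eLpNorm (F u - F u' : Lp ℝ q μ) r μ ≤
      ENNReal.ofReal (c * ‖u - u'‖ ^ γ * (N : ℝ) ^ (-(γ - 1))) := by
    intro N hN
    have hN' : (0 : ℝ) < N := by exact_mod_cast hN
    have hind : ∀ n : ℕ, eLpNorm (F u - F (u + ((n : ℝ) / N) • (u' - u)) : Lp ℝ q μ) r μ ≤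
        ENNReal.ofReal (n * (c * (‖u - u'‖ / N) ^ γ)) := by
      intro n
      induction n with
      | zero =>
        simp only [CharP.cast_eq_zero, zero_div, zero_smul, add_zero, sub_self, zero_mul,
          ENNReal.ofReal_zero, nonpos_iff_eq_zero]
        rw [eLpNorm_congr_ae (Lp.coeFn_zero ℝ q μ), eLpNorm_zero]
      | succ n ih =>
        have h1 := eLpNorm_coe_add_le (F u - F (u + ((n : ℝ) / N) • (u' - u)))
          (F (u + ((n : ℝ) / N) • (u' - u)) - F (u + (((n + 1 : ℕ) : ℝ) / N) • (u' - u))) hr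
        rw [sub_add_sub_cancel] at h1
        refine h1.trans ((add_le_add ih (hF _ _)).trans (le_of_eq ?_))
        have h2 : u + ((n : ℝ) / N) • (u' - u) - (u + (((n + 1 : ℕ) : ℝ) / N) • (u' - u)) =
            (1 / (N : ℝ)) • (u - u') := by
          push_cast; rw [add_div]; module
        rw [h2, norm_smul, Real.norm_of_nonneg (by positivity), one_div, inv_mul_eq_div,
          ← ENNReal.ofReal_add (by positivity) (by positivity)]
        congr 1; push_cast; ring
    have h3 := hind N
    rw [div_self hN'.ne', one_smul, add_sub_cancel] at h3
    refine h3.trans (le_of_eq ?_)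
    congr 1
    rw [Real.div_rpow (norm_nonneg _) hN'.le, neg_sub, Real.rpow_sub hN', Real.rpow_one]
    ring
  have hlim : Tendsto (fun N : ℕ => ENNReal.ofReal (c * ‖u - u'‖ ^ γ * (N : ℝ) ^ (-(γ - 1))))
      atTop (𝓝 0) := by
    have h1 := ((tendsto_rpow_neg_atTop (sub_pos.2 hγ)).comp
      (tendsto_natCast_atTop_atTop (R := ℝ))).const_mul (c * ‖u - u'‖ ^ γ)
    rw [mul_zero] at h1
    have h2 := (ENNReal.continuous_ofReal.tendsto _).comp h1
    rwa [ENNReal.ofReal_zero] at h2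
  have h0 : eLpNorm (F u - F u' : Lp ℝ q μ) r μ ≤ 0 :=
    ge_of_tendsto hlim ((eventually_gt_atTop 0).mono key)
  rw [nonpos_iff_eq_zero, eLpNorm_eq_zero_iff (Lp.aestronglyMeasurable _)
    (zero_lt_one.trans_le hr).ne', ← Lp.eq_zero_iff_ae_eq_zero, sub_eq_zero] at h0
  exact h0

/-- On the domain T_t x → x as t → 0, so maps constant at every t > 0 leave room for at most one
point of the domain, which is dense. -/
theorem IsQuasiMAccretive.subsingleton_of_semigroup_const {X : Type*} [NormedAddCommGroup X]
    [NormedSpace ℝ X] [CompleteSpace X] {A : Set (X × X)} {ω : ℝ} (hA : IsQuasiMAccretive A ω)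
    (hD : Dense (effDomain A))
    (hconst : ∀ t : ℝ, 0 < t → ∀ u u', semigroup A t u = semigroup A t u') : Subsingleton X := by
  have hsub : (effDomain A).Subsingleton := by
    rintro x ⟨v, hv⟩ y ⟨w, hw⟩
    have hlim : Tendsto (fun t : ℝ => Real.exp (t * ω + 1) * (t * ‖v‖) +
        Real.exp (t * ω + 1) * (t * ‖w‖)) (𝓝[>] 0) (𝓝 0) := by
      have : Continuous fun t : ℝ => Real.exp (t * ω + 1) * (t * ‖v‖) +
        Real.exp (t * ω + 1) * (t * ‖w‖) := by fun_prop
      have h1 := this.tendsto 0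
      simp only [zero_mul, mul_zero, add_zero] at h1
      exact h1.mono_left nhdsWithin_le_nhds
    have hle : ‖x - y‖ ≤ 0 := by
      refine ge_of_tendsto hlim ?_
      filter_upwards [self_mem_nhdsWithin] with t ht
      have h1 := hA.norm_semigroup_sub_self_le hD ht hv
      have h2 := hA.norm_semigroup_sub_self_le hD ht hw
      rw [hconst t ht y x] at h2
      have h3 := norm_sub_le (semigroup A t x - y) (semigroup A t x - x)
      rw [show semigroup A t x - y - (semigroup A t x - x) = x - y by abel] at h3
      linarith
    exact sub_eq_zero.1 (norm_le_zero_iff.1 hle)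
  have := hsub.closure
  rw [hD.closure_eq] at this
  exact Set.subsingleton_univ_iff.1 this

theorem measure_eq_zero_of_subsingleton_Lp [Fact (1 ≤ q)] [SigmaFinite μ] (hq : q ≠ ∞)
    (h : Subsingleton (Lp ℝ q μ)) : μ = 0 := by
  have hS : ∀ n, μ (spanningSets μ n) = 0 := by
    intro n
    have hs := measurableSet_spanningSets μ n
    have hfin := (measure_spanningSets_lt_top μ n).ne
    have h1 : indicatorConstLp q hs hfin (1 : ℝ) = 0 := Subsingleton.elim _ _
    have hq0 : q ≠ 0 := (zero_lt_one.trans_le (Fact.out : 1 ≤ q)).ne'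
    have h2 := norm_indicatorConstLp (c := (1 : ℝ)) (hs := hs) (hμs := hfin) hq0 hq
    rw [h1, norm_zero, norm_one, one_mul] at h2
    have h3 := (Real.rpow_eq_zero measureReal_nonneg
      (one_div_pos.2 (ENNReal.toReal_pos hq0 hq)).ne').1 h2.symm
    exact (measureReal_eq_zero_iff hfin).1 h3
  rw [← Measure.measure_univ_eq_zero, ← iUnion_spanningSets μ]
  exact measure_iUnion_null hS

end SuperlinearHolder

/-! ### Truncation and the De Giorgi iteration -/

section Regularization

variable {Ω : Type*} [MeasurableSpace Ω] {μ : Measure Ω} {q : ℝ≥0∞}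

/-- Common core of the interpolation argument and of the Chebyshev-type truncation bound, where c is
a power of the bound M or of the height k. -/
theorem eLpNorm_le_of_rpow_le {p s : ℝ≥0∞} (hp0 : p ≠ 0) (hp : p ≠ ∞) (hs0 : s ≠ 0) (hs : s ≠ ∞)
    {f g : Ω → ℝ} {c W : ℝ} (hc : 0 ≤ c) (hW : 0 ≤ W)
    (h : ∀ᵐ x ∂μ, |f x| ^ p.toReal ≤ c * |g x| ^ s.toReal)
    (hg : eLpNorm g s μ ≤ ENNReal.ofReal W) :
    eLpNorm f p μ ≤ ENNReal.ofReal ((c * W ^ s.toReal) ^ (1 / p.toReal)) := by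
  have hp' := ENNReal.toReal_pos hp0 hp
  have hs' := ENNReal.toReal_pos hs0 hs
  rw [eLpNorm_eq_lintegral_rpow_enorm_toReal hs0 hs] at hg
  have h1 : ∫⁻ x, ‖g x‖ₑ ^ s.toReal ∂μ ≤ ENNReal.ofReal (W ^ s.toReal) := by
    have := ENNReal.rpow_le_rpow hg hs'.le
    rwa [← ENNReal.rpow_mul, one_div_mul_cancel hs'.ne', ENNReal.rpow_one,
      ENNReal.ofReal_rpow_of_nonneg hW hs'.le] at this
  rw [eLpNorm_eq_lintegral_rpow_enorm_toReal hp0 hp,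
    ← ENNReal.ofReal_rpow_of_nonneg (by positivity) (by positivity)]
  refine ENNReal.rpow_le_rpow ?_ (by positivity)
  calc ∫⁻ x, ‖f x‖ₑ ^ p.toReal ∂μ ≤ ∫⁻ x, ENNReal.ofReal c * ‖g x‖ₑ ^ s.toReal ∂μ := by
        refine lintegral_mono_ae (h.mono fun x hx => ?_)
        rw [Real.enorm_eq_ofReal_abs, Real.enorm_eq_ofReal_abs,
          ENNReal.ofReal_rpow_of_nonneg (abs_nonneg _) hp'.le,
          ENNReal.ofReal_rpow_of_nonneg (abs_nonneg _) hs'.le, ← ENNReal.ofReal_mul hc]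
        exact ENNReal.ofReal_le_ofReal hx
    _ = ENNReal.ofReal c * ∫⁻ x, ‖g x‖ₑ ^ s.toReal ∂μ := lintegral_const_mul' _ _ (by simp)
    _ ≤ ENNReal.ofReal c * ENNReal.ofReal (W ^ s.toReal) := by gcongr
    _ = _ := (ENNReal.ofReal_mul hc).symm

theorem norm_le_of_eLpNorm_le {f : Lp ℝ q μ} {c : ℝ} (hc : 0 ≤ c)
    (h : eLpNorm f q μ ≤ ENNReal.ofReal c) : ‖f‖ ≤ c := by
  rw [Lp.norm_def]
  exact ENNReal.toReal_le_of_le_ofReal hc h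

theorem eLpNorm_eq_ofReal_norm (f : Lp ℝ q μ) : eLpNorm f q μ = ENNReal.ofReal ‖f‖ := by
  rw [Lp.norm_def, ENNReal.ofReal_toReal (Lp.eLpNorm_ne_top f)]

variable [Fact (1 ≤ q)]

theorem one_le_toReal_of_fact (hq : q ≠ ∞) : 1 ≤ q.toReal := by
  simpa using ENNReal.toReal_mono hq (Fact.out : 1 ≤ q)

theorem ne_zero_of_fact : q ≠ 0 := (zero_lt_one.trans_le (Fact.out : 1 ≤ q)).ne'

/-- Interpolation of `L^q` between `L^s` and `L^∞`. -/
theorem norm_le_of_eLpNorm_le_of_eLpNorm_top_le (hq : q ≠ ∞) {s : ℝ≥0∞} (hs0 : s ≠ 0)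
    (hsq : s ≤ q) (f : Lp ℝ q μ) {W M : ℝ} (hW : 0 ≤ W) (hM : 0 ≤ M)
    (hfs : eLpNorm f s μ ≤ ENNReal.ofReal W) (hf : eLpNorm f ∞ μ ≤ ENNReal.ofReal M) :
    ‖f‖ ≤ (M ^ (q.toReal - s.toReal) * W ^ s.toReal) ^ (1 / q.toReal) := by
  have hs : s ≠ ∞ := ne_top_of_le_ne_top hq hsq
  have hs' := ENNReal.toReal_pos hs0 hs
  have hle : s.toReal ≤ q.toReal := ENNReal.toReal_mono hq hsq
  refine norm_le_of_eLpNorm_le (by positivity)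
    (eLpNorm_le_of_rpow_le ne_zero_of_fact hq hs0 hs (by positivity) hW ?_ hfs)
  filter_upwards [ae_le_eLpNormEssSup (f := f) (μ := μ)] with x hx
  have hx' : |f x| ≤ M := by
    rw [eLpNorm_exponent_top] at hf
    have := hx.trans hf
    rw [Real.enorm_eq_ofReal_abs] at this
    exact (ENNReal.ofReal_le_ofReal_iff hM).1 this
  have : q.toReal = (q.toReal - s.toReal) + s.toReal := by ring
  nth_rewrite 1 [this]
  rw [Real.rpow_add_of_nonneg (abs_nonneg _) (by linarith) hs'.le]
  gcongr

/-- Splitting a function into a part bounded by `k` and a remainder. -/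
theorem exists_truncation (hq : q ≠ ∞) (f : Lp ℝ q μ) {k : ℝ} (hk : 0 < k) {s : ℝ≥0∞}
    (hs : s ≠ ∞) (hqs : q ≤ s) {W : ℝ} (hW : 0 ≤ W) (hfs : eLpNorm f s μ ≤ ENNReal.ofReal W) :
    ∃ g : Lp ℝ q μ, eLpNorm g ∞ μ ≤ ENNReal.ofReal k ∧
      ‖f - g‖ ≤ (k ^ (q.toReal - s.toReal) * W ^ s.toReal) ^ (1 / q.toReal) := by
  have hq0 : q ≠ 0 := ne_zero_of_fact
  have hs0 : s ≠ 0 := (lt_of_lt_of_le (pos_iff_ne_zero.2 hq0) hqs).ne'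
  have hle : q.toReal ≤ s.toReal := ENNReal.toReal_mono hs hqs
  have hQ := ENNReal.toReal_pos hq0 hq
  have hS := ENNReal.toReal_pos hs0 hs
  set φ : ℝ → ℝ := fun x => max (-k) (min k x) with hφ
  have hφc : Continuous φ := by fun_prop
  have hφk : ∀ x, |φ x| ≤ k := fun x =>
    abs_le.2 ⟨le_max_left _ _, max_le (by linarith) (min_le_left _ _)⟩
  have hφx : ∀ x, |x| ≤ k → φ x = x := fun x hx => by
    rw [abs_le] at hx
    simp only [hφ, min_eq_right hx.2, max_eq_right hx.1]
  have hφle : ∀ x, |φ x| ≤ |x| := fun x => by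
    rcases le_total |x| k with h | h
    · rw [hφx x h]
    · exact (hφk x).trans h
  have hφsub : ∀ x, |x - φ x| ≤ |x| := fun x => by
    simp only [hφ]
    rcases le_total k x with h | h
    · rw [min_eq_left h, max_eq_right (by linarith), abs_of_nonneg (by linarith),
        abs_of_nonneg (by linarith)]
      linarith
    · rw [min_eq_right h]
      rcases le_total (-k) x with h' | h'
      · rw [max_eq_right h']; simp
      · rw [max_eq_left h', abs_of_nonpos (by linarith), abs_of_nonpos (by linarith)]
        linarith
  have hmem : MemLp (fun x => φ (f x)) q μ :=
    (Lp.memLp f).mono (hφc.comp_aestronglyMeasurable (Lp.aestronglyMeasurable f))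
      (Eventually.of_forall fun x => hφle _)
  refine ⟨hmem.toLp _, ?_, norm_le_of_eLpNorm_le (by positivity)
    (eLpNorm_le_of_rpow_le hq0 hq hs0 hs (by positivity) hW ?_ hfs)⟩
  · rw [eLpNorm_congr_ae hmem.coeFn_toLp, eLpNorm_exponent_top]
    refine eLpNormEssSup_le_of_ae_enorm_bound (Eventually.of_forall fun x => ?_)
    rw [Real.enorm_eq_ofReal_abs]
    exact ENNReal.ofReal_le_ofReal (hφk _)
  · filter_upwards [Lp.coeFn_sub f (hmem.toLp _), hmem.coeFn_toLp] with x h1 h2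
    rw [h1, Pi.sub_apply, h2]
    -- The remainder vanishes where |f| ≤ k; elsewhere |f|^q = |f|^(q-s) |f|^s ≤ k^(q-s) |f|^s, as q
    -- ≤ s.
    rcases le_total |f x| k with h | h
    · rw [hφx _ h, sub_self, abs_zero, Real.zero_rpow hQ.ne']
      positivity
    · have hpos : 0 < |f x| := by linarith
      calc |f x - φ (f x)| ^ q.toReal ≤ |f x| ^ q.toReal :=
            Real.rpow_le_rpow (abs_nonneg _) (hφsub _) hQ.le
        _ = |f x| ^ (q.toReal - s.toReal) * |f x| ^ s.toReal := by
            rw [← Real.rpow_add hpos]; congr 1; ring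
        _ ≤ _ := by
            gcongr ?_ * _
            exact Real.rpow_le_rpow_of_nonpos hk h (by linarith)

/-- A semigroup on `L^q` that is Lipschitz in all `L^p` norms and Hölder from `L^q` to `L^r`. -/
structure IsRegularizing (T : ℝ → Lp ℝ q μ → Lp ℝ q μ) (r : ℝ≥0∞) (c a b γ ω : ℝ) : Prop where
  nonneg : 0 ≤ ω
  zero : ∀ u, T 0 u = u
  add : ∀ t s : ℝ, 0 ≤ t → 0 ≤ s → ∀ u, T (t + s) u = T t (T s u)
  lipschitz : ∀ t : ℝ, 0 ≤ t → ∀ p : ℝ≥0∞, 1 ≤ p → ∀ u u',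
    eLpNorm (T t u - T t u' : Lp ℝ q μ) p μ ≤
      ENNReal.ofReal (Real.exp (ω * t)) * eLpNorm (u - u' : Lp ℝ q μ) p μ
  holder : ∀ t : ℝ, 0 < t → ∀ u u', eLpNorm (T t u - T t u' : Lp ℝ q μ) r μ ≤
    ENNReal.ofReal (c * t ^ (-a) * Real.exp (ω * b * t) * ‖u - u'‖ ^ γ)

/-- `u` is `ε`-close in `L^q` to a function which is `k`-close to `u'` in `L^∞`. -/
def Near (u u' : Lp ℝ q μ) (k ε : ℝ) : Prop :=
  ∃ p : Lp ℝ q μ, ‖u - p‖ ≤ ε ∧ eLpNorm (p - u' : Lp ℝ q μ) ∞ μ ≤ ENNReal.ofReal k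

variable {T : ℝ → Lp ℝ q μ → Lp ℝ q μ} {r : ℝ≥0∞} {c a b γ ω : ℝ}

/-- The Hölder bound controls T_t u - T_t p in L^r. Its truncation at height k' is added to the
approximant T_t p, which costs k' in L^∞, and what remains is small in L^q. -/
theorem IsRegularizing.near_step (hT : IsRegularizing T r c a b γ ω) (hq : q ≠ ∞) (hr : r ≠ ∞)
    (hqr : q ≤ r) (hc : 0 ≤ c) (hγ : 0 ≤ γ) {t : ℝ} (ht : 0 < t) {k k' ε : ℝ}
    (hk : 0 ≤ k) (hk' : 0 < k') (hε : 0 ≤ ε) {u u' : Lp ℝ q μ} (h : Near u u' k ε) :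
    Near (T t u) (T t u') (Real.exp (ω * t) * k + k')
      ((k' ^ (q.toReal - r.toReal) *
        (c * t ^ (-a) * Real.exp (ω * b * t) * ε ^ γ) ^ r.toReal) ^ (1 / q.toReal)) := by
  obtain ⟨p, hp, hpu⟩ := h
  have h1 : eLpNorm (T t u - T t p : Lp ℝ q μ) r μ ≤
      ENNReal.ofReal (c * t ^ (-a) * Real.exp (ω * b * t) * ε ^ γ) := by
    refine (hT.holder t ht u p).trans (ENNReal.ofReal_le_ofReal ?_)
    gcongr
  obtain ⟨g, hg, hfg⟩ := exists_truncation hq _ hk' hr hqr (by positivity) h1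
  refine ⟨T t p + g, ?_, ?_⟩
  · rwa [← sub_sub]
  · rw [show T t p + g - T t u' = (T t p - T t u') + g by abel,
      ENNReal.ofReal_add (by positivity) hk'.le, ENNReal.ofReal_mul (Real.exp_pos _).le]
    refine (eLpNorm_coe_add_le _ _ le_top).trans (add_le_add ?_ hg)
    refine (hT.lipschitz t ht.le ∞ le_top _ _).trans ?_
    gcongr

/-- The De Giorgi iteration. -/
theorem IsRegularizing.eLpNorm_top_le_of_near (hT : IsRegularizing T r c a b γ ω) (hq : q ≠ ∞)
    (hr : r ≠ ∞) (hqr : q < r) (hc : 0 ≤ c) (ha : 0 ≤ a) (hb : 0 ≤ b) (hγ : 0 ≤ γ)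
    (hγr : q.toReal < γ * r.toReal) {t k ε η : ℝ} (ht : 0 < t) (hk : 0 < k) (hε : 0 < ε)
    (hη : η = 2 ^ (-((r.toReal - q.toReal + a * r.toReal) / (γ * r.toReal - q.toReal))))
    (hkε : k ^ (q.toReal - r.toReal) * (η ^ (-(γ * r.toReal)) * c ^ r.toReal *
      t ^ (-(a * r.toReal)) * Real.exp (ω * b * r.toReal * t)) *
      ε ^ (γ * r.toReal - q.toReal) ≤ 1)
    {u u' : Lp ℝ q μ} (h : Near u u' k ε) :
    eLpNorm (T t u - T t u' : Lp ℝ q μ) ∞ μ ≤ ENNReal.ofReal (Real.exp (ω * t) * (2 * k)) := by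
  have hω := hT.nonneg
  have hQ : 1 ≤ q.toReal := one_le_toReal_of_fact hq
  have hQR : q.toReal < r.toReal := (ENNReal.toReal_lt_toReal hq hr).2 hqr
  set Q := q.toReal
  set R := r.toReal
  have hden : 0 < γ * R - Q := by linarith
  -- The ratio η = 2^(-δ) solves η^(γR-Q) = 2^(-(R-Q+aR)): the superlinear gain in the error exactly
  -- pays for halving time and height.
  set δ := (R - Q + a * R) / (γ * R - Q) with hδ
  have hδpos : 0 < δ := by
    have : 0 ≤ a * R := by apply mul_nonneg ha; linarith
    apply div_pos <;> linarith
  have hη0 : 0 < η := by rw [hη]; positivity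
  have hη1 : η < 1 := by
    rw [hη]; exact Real.rpow_lt_one_of_one_lt_of_neg (by norm_num) (by linarith)
  set x : ℕ → ℝ := fun n => (2⁻¹ : ℝ) ^ n with hx
  have hx0 : ∀ n, 0 < x n := fun n => by simp only [hx]; positivity
  have hx1 : ∀ n, x n ≤ 1 := fun n => pow_le_one₀ (by norm_num) (by norm_num)
  have hxs : ∀ n, x (n + 1) = x n / 2 := fun n => by simp only [hx, pow_succ]; ring
  have hnum : ∀ n : ℕ, (((k * x (n + 1)) ^ (Q - R) *
      (c * (t * x (n + 1)) ^ (-a) * Real.exp (ω * b * (t * x (n + 1))) *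
        (ε * η ^ n) ^ γ) ^ R) ^ (1 / Q)) ≤ ε * η ^ (n + 1) := by
    intro n
    have hxn := hx0 (n + 1)
    rw [one_div, Real.rpow_inv_le_iff_of_pos (by positivity) (by positivity) (by linarith)]
    have hηn : ∀ m : ℕ, η ^ m = (2 : ℝ) ^ (-(δ * m)) := fun m => by
      rw [hη, ← Real.rpow_natCast, ← Real.rpow_mul (by norm_num), neg_mul]
    have hxm : x (n + 1) = (2 : ℝ) ^ (-((n + 1 : ℕ) : ℝ)) := by
      simp only [hx]
      rw [Real.rpow_neg (by norm_num), Real.rpow_natCast, inv_pow]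
    have hexp : Real.exp (ω * b * (t * x (n + 1))) ^ R ≤ Real.exp (ω * b * R * t) := by
      rw [← Real.exp_mul]
      refine Real.exp_le_exp.2 ?_
      have h1 : ω * b * R * t * x (n + 1) ≤ ω * b * R * t * 1 :=
        mul_le_mul_of_nonneg_left (hx1 _) (by positivity)
      linarith
    have htwo : x (n + 1) ^ (Q - R) * x (n + 1) ^ (-(a * R)) * (η ^ n) ^ (γ * R) =
        η ^ (-(γ * R)) * (η ^ (n + 1)) ^ Q := by
      rw [hηn, hηn, hxm]
      nth_rewrite 1 [hη]
      simp only [← Real.rpow_mul (show (0 : ℝ) ≤ 2 by norm_num)]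
      simp only [← Real.rpow_add (show (0 : ℝ) < 2 by norm_num)]
      congr 1
      have : δ * (γ * R - Q) = R - Q + a * R := by
        rw [hδ, div_mul_cancel₀ _ hden.ne']
      push_cast
      linear_combination (-(n : ℝ) - 1) * this
    have hL : (k * x (n + 1)) ^ (Q - R) * (c * (t * x (n + 1)) ^ (-a) *
        Real.exp (ω * b * (t * x (n + 1))) * (ε * η ^ n) ^ γ) ^ R =
        k ^ (Q - R) * c ^ R * t ^ (-(a * R)) * Real.exp (ω * b * (t * x (n + 1))) ^ R *
          ε ^ (γ * R) * (x (n + 1) ^ (Q - R) * x (n + 1) ^ (-(a * R)) * (η ^ n) ^ (γ * R)) := by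
      rw [Real.mul_rpow hk.le hxn.le, Real.mul_rpow (by positivity) (by positivity),
        Real.mul_rpow (by positivity) (by positivity), Real.mul_rpow hc (by positivity),
        Real.mul_rpow ht.le hxn.le, Real.mul_rpow (by positivity) (by positivity),
        Real.mul_rpow hε.le (by positivity), Real.mul_rpow (by positivity) (by positivity),
        ← Real.rpow_mul ht.le, ← Real.rpow_mul hxn.le, ← Real.rpow_mul hε.le,
        ← Real.rpow_mul (by positivity : (0 : ℝ) ≤ η ^ n), neg_mul]
      ring
    have hεpow : ε ^ (γ * R) = ε ^ (γ * R - Q) * ε ^ Q := by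
      rw [← Real.rpow_add hε]; congr 1; ring
    rw [hL, htwo, hεpow, Real.mul_rpow hε.le (by positivity)]
    calc k ^ (Q - R) * c ^ R * t ^ (-(a * R)) * Real.exp (ω * b * (t * x (n + 1))) ^ R *
          (ε ^ (γ * R - Q) * ε ^ Q) * (η ^ (-(γ * R)) * (η ^ (n + 1)) ^ Q)
        ≤ k ^ (Q - R) * c ^ R * t ^ (-(a * R)) * Real.exp (ω * b * R * t) *
          (ε ^ (γ * R - Q) * ε ^ Q) * (η ^ (-(γ * R)) * (η ^ (n + 1)) ^ Q) := by gcongr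
      _ = (k ^ (Q - R) * (η ^ (-(γ * R)) * c ^ R * t ^ (-(a * R)) *
          Real.exp (ω * b * R * t)) * ε ^ (γ * R - Q)) * (ε ^ Q * (η ^ (n + 1)) ^ Q) := by ring
      _ ≤ 1 * (ε ^ Q * (η ^ (n + 1)) ^ Q) := by gcongr
      _ = _ := one_mul _
  -- At time t(1 - 2^(-n)) the heights k, k/2, ..., k/2^n spent so far sum to k(2 - 2^(-n)).
  have hmain : ∀ n : ℕ, Near (T (t * (1 - x n)) u) (T (t * (1 - x n)) u')
      (Real.exp (ω * (t * (1 - x n))) * (k * (2 - x n))) (ε * η ^ n) := by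
    intro n
    induction n with
    | zero =>
      have : x 0 = 1 := by simp [hx]
      rw [this]
      simp only [sub_self, mul_zero, hT.zero, Real.exp_zero, pow_zero, mul_one, one_mul]
      norm_num
      exact h
    | succ n ih =>
      have hxn := hx0 (n + 1)
      have hxn1 := hx1 n
      have hstep := hT.near_step hq hr hqr.le hc hγ (t := t * x (n + 1)) (by positivity)
        (k' := k * x (n + 1))
        (mul_nonneg (Real.exp_pos _).le (mul_nonneg hk.le (by linarith [hx1 n]))) (by positivity)
        (by positivity) ih
      rw [← hT.add _ _ (by positivity) (mul_nonneg ht.le (by linarith)),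
        ← hT.add _ _ (by positivity) (mul_nonneg ht.le (by linarith)),
        show t * x (n + 1) + t * (1 - x n) = t * (1 - x (n + 1)) by rw [hxs]; ring] at hstep
      obtain ⟨p, hp1, hp2⟩ := hstep
      refine ⟨p, hp1.trans (hnum n), hp2.trans (ENNReal.ofReal_le_ofReal ?_)⟩
      rw [← mul_assoc, ← Real.exp_add, ← mul_add,
        show t * x (n + 1) + t * (1 - x n) = t * (1 - x (n + 1)) by rw [hxs]; ring]
      have h1 : 1 ≤ Real.exp (ω * (t * (1 - x (n + 1)))) :=
        Real.one_le_exp (mul_nonneg hω (mul_nonneg ht.le (by linarith [hx1 (n + 1)])))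
      have h2 : k * x (n + 1) ≤ Real.exp (ω * (t * (1 - x (n + 1)))) * (k * x (n + 1)) :=
        le_mul_of_one_le_left (by positivity) h1
      have h3 : k * (2 - x (n + 1)) = k * (2 - x n) + k * x (n + 1) := by rw [hxs]; ring
      rw [h3, mul_add]
      linarith
  choose p hp1 hp2 using hmain
  have hsplit : ∀ n (v : Lp ℝ q μ), T t v = T (t * x n) (T (t * (1 - x n)) v) := fun n v => by
    rw [← hT.add _ _ (mul_nonneg ht.le (hx0 n).le) (mul_nonneg ht.le (by linarith [hx1 n]))]
    congr 1; ring
  -- Flowed over the remaining time, the approximants converge to T_t u in L^q, so their uniform L^∞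
  -- bound passes to the limit.
  have hlim : Tendsto (fun n => T (t * x n) (p n) - T t u') atTop (𝓝 (T t u - T t u')) := by
    refine Tendsto.sub_const ?_ _
    rw [tendsto_iff_norm_sub_tendsto_zero]
    have h0 : Tendsto (fun n => Real.exp (ω * t) * (ε * η ^ n)) atTop (𝓝 0) := by
      simpa using ((tendsto_pow_atTop_nhds_zero_of_lt_one hη0.le hη1).const_mul ε).const_mul
        (Real.exp (ω * t))
    refine squeeze_zero (fun _ => norm_nonneg _) (fun n => ?_) h0
    rw [hsplit n u, norm_sub_rev]
    have h1 := hT.lipschitz (t * x n) (mul_nonneg ht.le (hx0 n).le) q Fact.out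
      (T (t * (1 - x n)) u) (p n)
    rw [eLpNorm_eq_ofReal_norm (T (t * (1 - x n)) u - p n),
      ← ENNReal.ofReal_mul (Real.exp_pos _).le] at h1
    refine (norm_le_of_eLpNorm_le (by positivity) h1).trans ?_
    gcongr
    · nlinarith [hx1 n]
    · exact hp1 n
  refine eLpNorm_le_of_tendsto_Lp hlim (Eventually.of_forall fun n => ?_) tendsto_const_nhds
  rw [hsplit n u']
  refine (hT.lipschitz (t * x n) (mul_nonneg ht.le (hx0 n).le) ∞ le_top _ _).trans ?_
  refine (mul_le_mul_right (hp2 n) _).trans ?_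
  rw [← ENNReal.ofReal_mul (Real.exp_pos _).le, ← mul_assoc, ← Real.exp_add]
  refine ENNReal.ofReal_le_ofReal ?_
  rw [show ω * (t * x n) + ω * (t * (1 - x n)) = ω * t by ring]
  refine mul_le_mul_of_nonneg_left ?_ (Real.exp_pos _).le
  nlinarith [hx0 n]

end Regularization

/-! ### L^s-L^∞ estimates with constants independent of the space -/

section Smoothing

universe u

/-- The `L^s`-`L^∞` estimate with constant `K` and exponents `α`, `β`, `g` for all regularizing
semigroups with given parameters. -/
def SmoothingBound (q r s : ℝ≥0∞) [Fact (1 ≤ q)] (c a b γ α β g K : ℝ) : Prop :=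
  ∀ (Ω : Type u) [MeasurableSpace Ω] (μ : Measure Ω) (T : ℝ → Lp ℝ q μ → Lp ℝ q μ) (ω : ℝ),
    IsRegularizing T r c a b γ ω → ∀ t : ℝ, 0 < t → ∀ (u u' : Lp ℝ q μ) (W : ℝ), 0 < W →
      eLpNorm (u - u' : Lp ℝ q μ) s μ ≤ ENNReal.ofReal W →
      eLpNorm (T t u - T t u' : Lp ℝ q μ) ∞ μ ≤
        ENNReal.ofReal (K * t ^ (-α) * Real.exp (ω * β * t) * W ^ g)

/-- The denominator shared by the exponents of the `L^s`-`L^∞` estimate. -/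
noncomputable def smoothingDenom (Q R S γ : ℝ) : ℝ := (γ * R / Q - 1) * S + R * (1 - γ)

variable {q r s : ℝ≥0∞} [Fact (1 ≤ q)] {c a b γ : ℝ}

theorem smoothingDenom_pos {Q R S : ℝ} (hQ : 0 < Q) (hR : 0 < R) (hS : 0 < S) (hγ1 : γ ≤ 1)
    (hγR : Q < γ * R) : 0 < smoothingDenom Q R S γ := by
  have h1 : 0 < γ * R / Q - 1 := by rw [sub_pos, lt_div_iff₀ hQ]; linarith
  have h2 : 0 ≤ R * (1 - γ) := mul_nonneg hR.le (by linarith)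
  have := mul_pos h1 hS
  unfold smoothingDenom
  linarith

/-- Truncating u - u' at k leaves the L^q error (k^(q-s) W^s)^(1/q). Requiring equality in the
smallness condition of the iteration gives k^E = M W^(κs), with E the value of `smoothingDenom`; all
exponents are read off from this k. -/
theorem exists_smoothingBound_of_le (hq : q ≠ ∞) (hr : r ≠ ∞) (hs : s ≠ ∞) (hqs : q ≤ s)
    (hc : 0 < c) (ha : 0 ≤ a) (hb : 0 ≤ b) (hγ : 0 ≤ γ) (hγ1 : γ ≤ 1)
    (hγR : q.toReal < γ * r.toReal) :
    ∃ K β : ℝ, 0 ≤ K ∧ 0 ≤ β ∧ SmoothingBound.{u} q r s c a b γ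
      (a * r.toReal / smoothingDenom q.toReal r.toReal s.toReal γ) β
      ((γ * r.toReal / q.toReal - 1) * s.toReal /
        smoothingDenom q.toReal r.toReal s.toReal γ) K := by
  have hQ : 1 ≤ q.toReal := one_le_toReal_of_fact hq
  have hQS : q.toReal ≤ s.toReal := ENNReal.toReal_mono hs hqs
  have hR0 : 0 ≤ r.toReal := ENNReal.toReal_nonneg
  have hqr : q < r := by
    rw [← ENNReal.toReal_lt_toReal hq hr]; nlinarith
  have hR : 0 < r.toReal := by
    have := (ENNReal.toReal_lt_toReal hq hr).2 hqr; linarith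
  set Q := q.toReal
  set R := r.toReal
  set S := s.toReal
  have hQ0 : 0 < Q := by linarith
  have hS : 0 < S := by linarith
  have hEpos := smoothingDenom_pos hQ0 hR hS hγ1 hγR
  set E := smoothingDenom Q R S γ with hE
  set η : ℝ := 2 ^ (-((R - Q + a * R) / (γ * R - Q))) with hη
  have hη0 : 0 < η := by rw [hη]; positivity
  refine ⟨2 * (η ^ (-(γ * R)) * c ^ R) ^ (1 / E), 1 + b * R / E, by positivity, by positivity, ?_⟩
  intro Ω _ μ T ω hT t ht u u' W hW huW
  set κ := γ * R / Q - 1 with hκ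
  set M := η ^ (-(γ * R)) * c ^ R * t ^ (-(a * R)) * Real.exp (ω * b * R * t) with hM
  have hM0 : 0 < M := by positivity
  set k := (M * W ^ (κ * S)) ^ (1 / E) with hk
  have hk0 : 0 < k := by positivity
  obtain ⟨g, hg1, hg2⟩ := exists_truncation hq (u - u') hk0 hs hqs hW.le huW
  have hnear : Near u u' k ((k ^ (Q - S) * W ^ S) ^ (1 / Q)) :=
    ⟨u' + g, by rwa [← sub_sub], by rwa [add_sub_cancel_left]⟩
  have hkE : k ^ E = M * W ^ (κ * S) := by
    rw [hk, ← Real.rpow_mul (by positivity), one_div_mul_cancel hEpos.ne', Real.rpow_one]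
  have hcond : k ^ (Q - R) * M * ((k ^ (Q - S) * W ^ S) ^ (1 / Q)) ^ (γ * R - Q) ≤ 1 := by
    refine le_of_eq ?_
    have e1 : ((k ^ (Q - S) * W ^ S) ^ (1 / Q)) ^ (γ * R - Q) =
        k ^ ((Q - S) * κ) * W ^ (κ * S) := by
      rw [← Real.rpow_mul (by positivity), Real.mul_rpow (by positivity) (by positivity),
        ← Real.rpow_mul hk0.le, ← Real.rpow_mul hW.le]
      have : 1 / Q * (γ * R - Q) = κ := by rw [hκ]; field_simp
      rw [this, mul_comm S κ]
    have e2 : k ^ (Q - R) * k ^ ((Q - S) * κ) * k ^ E = 1 := by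
      rw [← Real.rpow_add hk0, ← Real.rpow_add hk0]
      have : Q - R + (Q - S) * κ + E = 0 := by
        rw [hE, smoothingDenom, hκ]; field_simp; ring
      rw [this, Real.rpow_zero]
    rw [e1]
    rw [hkE] at e2
    linarith
  refine (hT.eLpNorm_top_le_of_near hq hr hqr hc.le ha hb hγ hγR ht hk0 (by positivity) hη hcond
    hnear).trans (ENNReal.ofReal_le_ofReal (le_of_eq ?_))
  rw [hk, hM, Real.mul_rpow (by positivity) (by positivity),
    Real.mul_rpow (by positivity) (by positivity), Real.mul_rpow (by positivity) (by positivity),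
    ← Real.rpow_mul ht.le, ← Real.rpow_mul hW.le, ← Real.exp_mul,
    show ω * (1 + b * R / E) * t = ω * t + ω * b * R * t * (1 / E) by ring, Real.exp_add,
    show -(a * R) * (1 / E) = -(a * R / E) by ring, mul_one_div]
  ring_nf

/-- Absorption: a self-improving estimate on dyadic times. -/
theorem le_rpow_of_le_mul_rpow_half {X : ℝ → ℝ} {H G t α δ : ℝ} (ht : 0 < t) (hH : 0 < H)
    (hG : 0 ≤ G) (hα : 0 ≤ α) (hδ0 : 0 ≤ δ) (hδ : δ < 1) (hX : ∀ τ, 0 ≤ X τ)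
    (hXG : ∀ τ, 0 < τ → τ ≤ t → X τ ≤ G * τ ^ (-α))
    (hXH : ∀ τ, 0 < τ → τ ≤ t → X τ ≤ H * τ ^ (-α) * X (τ / 2) ^ δ) :
    X t ≤ (H * 2 ^ (α / (1 - δ) * δ)) ^ (1 / (1 - δ)) * t ^ (-(α / (1 - δ))) := by
  have hδ' : 0 < 1 - δ := by linarith
  set α' := α / (1 - δ) with hα'
  have hαeq : α' * (1 - δ) = α := div_mul_cancel₀ _ hδ'.ne'
  have hα'0 : 0 ≤ α' := by positivity
  set H' := (H * 2 ^ (α' * δ)) ^ (1 / (1 - δ)) with hH'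
  have hH'0 : 0 < H' := by positivity
  have hH'eq : H' ^ (1 - δ) = H * 2 ^ (α' * δ) := by
    rw [hH', ← Real.rpow_mul (by positivity), one_div_mul_cancel hδ'.ne', Real.rpow_one]
  -- `M` is the excess of the a priori bound over the self-consistent bound H' τ^(-α'). Each use of
  -- `hXH` raises it to the power δ, and M^(δ^n) → 1, so `G` leaves no trace.
  set M := max 1 (G * t ^ (α' - α) / H') with hM
  have hM1 : 1 ≤ M := le_max_left _ _
  have hM0 : 0 < M := by linarith
  have key : ∀ n : ℕ, ∀ τ, 0 < τ → τ ≤ t → X τ ≤ M ^ (δ ^ n) * (H' * τ ^ (-α')) := by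
    intro n
    induction n with
    | zero =>
      intro τ hτ hτt
      refine (hXG τ hτ hτt).trans ?_
      have h1 : G * t ^ (α' - α) ≤ M * H' := by
        rw [← div_le_iff₀ hH'0]; exact le_max_right _ _
      have h2 : τ ^ (-α) = τ ^ (α' - α) * τ ^ (-α') := by
        rw [← Real.rpow_add hτ]; congr 1; ring
      have h3 : τ ^ (α' - α) ≤ t ^ (α' - α) :=
        Real.rpow_le_rpow hτ.le hτt (by rw [← hαeq]; nlinarith)
      rw [h2, pow_zero, Real.rpow_one, ← mul_assoc, ← mul_assoc]
      exact mul_le_mul_of_nonneg_right ((mul_le_mul_of_nonneg_left h3 hG).trans h1)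
        (by positivity)
    | succ n ih =>
      intro τ hτ hτt
      refine (hXH τ hτ hτt).trans ?_
      have h1 := Real.rpow_le_rpow (hX _) (ih (τ / 2) (by positivity) (by linarith)) hδ0
      refine (mul_le_mul_of_nonneg_left h1 (by positivity)).trans (le_of_eq ?_)
      have h2 : H' = H * 2 ^ (α' * δ) * H' ^ δ := by
        rw [← hH'eq, ← Real.rpow_add hH'0]; simp
      have h3 : τ ^ (-α') = τ ^ (-α) * τ ^ (-α' * δ) := by
        rw [← Real.rpow_add hτ, ← hαeq]; congr 1; ring
      have h4 : (τ / 2) ^ (-α' * δ) = τ ^ (-α' * δ) * 2 ^ (α' * δ) := by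
        rw [Real.div_rpow hτ.le (by norm_num), neg_mul, Real.rpow_neg (by norm_num : (0:ℝ) ≤ 2),
          div_inv_eq_mul]
      rw [Real.mul_rpow (by positivity) (by positivity), Real.mul_rpow hH'0.le (by positivity),
        ← Real.rpow_mul hM0.le, ← Real.rpow_mul (by positivity : (0 : ℝ) ≤ τ / 2), h4,
        ← pow_succ, h3]
      nth_rewrite 2 [h2]
      ring
  have hlim : Tendsto (fun n : ℕ => M ^ (δ ^ n) * (H' * t ^ (-α'))) atTop
      (𝓝 (H' * t ^ (-α'))) := by
    have h1 := tendsto_pow_atTop_nhds_zero_of_lt_one hδ0 hδ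
    have h2 := ((Real.continuous_const_rpow hM0.ne').tendsto 0).comp h1
    rw [Real.rpow_zero] at h2
    simpa using h2.mul_const (H' * t ^ (-α'))
  exact ge_of_tendsto' hlim fun n => key n t ht le_rfl

/-- The L^q-L^∞ bound is applied on [τ/2, τ] and the L^q norm at τ/2 is interpolated between L^s and
L^∞. The L^∞ norm at τ/2 then enters with the power δ, where 1 - δ is a quotient of two positive
denominators, so absorption applies. -/
theorem exists_smoothingBound_of_lt (hq : q ≠ ∞) (hr : r ≠ ∞) (hs : 1 ≤ s) (hsq : s < q)
    (hc : 0 < c) (ha : 0 ≤ a) (hb : 0 ≤ b) (hγ : 0 ≤ γ) (hγ1 : γ ≤ 1)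
    (hγR : q.toReal < γ * r.toReal) :
    ∃ K β : ℝ, 0 ≤ K ∧ 0 ≤ β ∧ SmoothingBound.{u} q r s c a b γ
      (a * r.toReal / smoothingDenom q.toReal r.toReal s.toReal γ) β
      ((γ * r.toReal / q.toReal - 1) * s.toReal /
        smoothingDenom q.toReal r.toReal s.toReal γ) K := by
  obtain ⟨K, β, hK, hβ, hbound⟩ :=
    exists_smoothingBound_of_le.{u} hq hr hq le_rfl hc ha hb hγ hγ1 hγR
  have hs' : s ≠ ∞ := ne_top_of_lt hsq
  have hQ : 1 ≤ q.toReal := one_le_toReal_of_fact hq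
  have hS : 1 ≤ s.toReal := by simpa using ENNReal.toReal_mono hs' hs
  have hSQ : s.toReal < q.toReal := (ENNReal.toReal_lt_toReal hs' hq).2 hsq
  have hR : 0 < r.toReal := by
    by_contra hcon
    push Not at hcon
    nlinarith
  have hs0 : s ≠ 0 := (zero_lt_one.trans_le hs).ne'
  set Q := q.toReal
  set R := r.toReal
  set S := s.toReal
  have hQ0 : 0 < Q := by linarith
  have hEQ := smoothingDenom_pos hQ0 hR hQ0 hγ1 hγR
  have hES := smoothingDenom_pos hQ0 hR (by linarith : 0 < S) hγ1 hγR
  have hκ : 0 < γ * R / Q - 1 := by rw [sub_pos, lt_div_iff₀ hQ0]; linarith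
  have hEE : smoothingDenom Q R Q γ - smoothingDenom Q R S γ = (γ * R / Q - 1) * (Q - S) := by
    unfold smoothingDenom; ring
  set EQ := smoothingDenom Q R Q γ
  set ES := smoothingDenom Q R S γ
  set κ := γ * R / Q - 1
  set g := κ * Q / EQ with hg
  have hg0 : 0 < g := by positivity
  set α := a * R / EQ with hα
  have hα0 : 0 ≤ α := by positivity
  set δ := g * ((Q - S) / Q) with hδ
  have hδ0 : 0 ≤ δ := mul_nonneg hg0.le (div_nonneg (by linarith) hQ0.le)
  have hδ1 : 1 - δ = ES / EQ := by
    rw [hδ, hg, eq_div_iff hEQ.ne', sub_mul]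
    have : κ * Q / EQ * ((Q - S) / Q) * EQ = κ * (Q - S) := by field_simp
    rw [this, ← hEE]; ring
  have hδlt : δ < 1 := by
    have : 0 < ES / EQ := by positivity
    linarith
  have hδ' : 0 < 1 - δ := by linarith
  have hαS : α / (1 - δ) = a * R / ES := by
    rw [hδ1, hα]; field_simp
  -- `K` may be 0, while absorption needs a positive constant.
  set K' := K + 1
  refine ⟨(K' * 2 ^ α * 2 ^ (α / (1 - δ) * δ)) ^ (1 / (1 - δ)), (β + g) / (1 - δ),
    by positivity, by positivity, ?_⟩
  intro Ω _ μ T ω hT t ht u u' W hW huW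
  have hω := hT.nonneg
  -- Any positive bound of the L^q norm will do: it enters only the a priori constant, which
  -- absorption removes.
  set N := ‖u - u'‖ + 1 with hN
  have hN0 : 0 < N := by positivity
  have huN : eLpNorm (u - u' : Lp ℝ q μ) q μ ≤ ENNReal.ofReal N := by
    rw [eLpNorm_eq_ofReal_norm]
    exact ENNReal.ofReal_le_ofReal (by linarith)
  set X : ℝ → ℝ := fun τ => (eLpNorm (T τ u - T τ u' : Lp ℝ q μ) ∞ μ).toReal with hX
  have hfirst := fun τ (hτ : 0 < τ) => hbound Ω μ T ω hT τ hτ u u' N hN0 huN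
  have hfin : ∀ τ, 0 < τ → eLpNorm (T τ u - T τ u' : Lp ℝ q μ) ∞ μ = ENNReal.ofReal (X τ) :=
    fun τ hτ => (ENNReal.ofReal_toReal (ne_top_of_le_ne_top ENNReal.ofReal_ne_top
      (hfirst τ hτ))).symm
  rw [hfin t ht]
  refine ENNReal.ofReal_le_ofReal ?_
  have habs := le_rpow_of_le_mul_rpow_half (X := X)
    (H := K' * 2 ^ α * Real.exp (ω * (β + g) * t) * W ^ (S / Q * g))
    (G := K * Real.exp (ω * β * t) * N ^ g) (t := t) (α := α) (δ := δ) ht (by positivity)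
    (by positivity) hα0 hδ0 hδlt (fun _ => ENNReal.toReal_nonneg) ?_ ?_
  · refine habs.trans (le_of_eq ?_)
    rw [hαS]
    rw [show K' * 2 ^ α * Real.exp (ω * (β + g) * t) * W ^ (S / Q * g) * 2 ^ (a * R / ES * δ) =
      K' * 2 ^ α * 2 ^ (a * R / ES * δ) * Real.exp (ω * (β + g) * t) * W ^ (S / Q * g) by ring,
      Real.mul_rpow (by positivity) (by positivity),
      Real.mul_rpow (by positivity) (by positivity), ← Real.rpow_mul hW.le, ← Real.exp_mul]
    have e1 : S / Q * g * (1 / (1 - δ)) = κ * S / ES := by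
      rw [hδ1, hg]; field_simp
    rw [e1, show ω * ((β + g) / (1 - δ)) * t = ω * (β + g) * t * (1 / (1 - δ)) by ring]
    ring
  · intro τ hτ hτt
    have h1 := ENNReal.toReal_le_of_le_ofReal (by positivity) (hfirst τ hτ)
    refine h1.trans ?_
    calc K * τ ^ (-α) * Real.exp (ω * β * τ) * N ^ g
        ≤ K * τ ^ (-α) * Real.exp (ω * β * t) * N ^ g := by gcongr
      _ = _ := by ring
  · intro τ hτ hτt
    have hτ2 : 0 < τ / 2 := by positivity
    have hXn : 0 ≤ X (τ / 2) := ENNReal.toReal_nonneg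
    have h1 : ‖T (τ / 2) u - T (τ / 2) u'‖ ≤
        (X (τ / 2) ^ (Q - S) * (Real.exp (ω * (τ / 2)) * W) ^ S) ^ (1 / Q) := by
      refine norm_le_of_eLpNorm_le_of_eLpNorm_top_le hq hs0 hsq.le _ (by positivity) hXn ?_
        (hfin _ hτ2).le
      refine (hT.lipschitz _ hτ2.le s hs u u').trans ?_
      rw [ENNReal.ofReal_mul (Real.exp_pos _).le]
      gcongr
    have hlimW : ∀ V : ℝ, 0 < V → ‖T (τ / 2) u - T (τ / 2) u'‖ ≤ V →
        X τ ≤ K * (τ / 2) ^ (-α) * Real.exp (ω * β * (τ / 2)) * V ^ g := by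
      intro V hV hle
      have h2 := hbound Ω μ T ω hT (τ / 2) hτ2 (T (τ / 2) u) (T (τ / 2) u') V hV (by
        rw [eLpNorm_eq_ofReal_norm]; exact ENNReal.ofReal_le_ofReal hle)
      rw [← hT.add _ _ hτ2.le hτ2.le, ← hT.add _ _ hτ2.le hτ2.le, add_halves] at h2
      exact ENNReal.toReal_le_of_le_ofReal (by positivity) h2
    have hV : X τ ≤ K * (τ / 2) ^ (-α) * Real.exp (ω * β * (τ / 2)) *
        ((X (τ / 2) ^ (Q - S) * (Real.exp (ω * (τ / 2)) * W) ^ S) ^ (1 / Q)) ^ g := by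
      -- `V` may vanish, so the bound for positive radii is used at V + e with e → 0.
      set V := (X (τ / 2) ^ (Q - S) * (Real.exp (ω * (τ / 2)) * W) ^ S) ^ (1 / Q) with hVdef
      have hV0 : 0 ≤ V := by positivity
      have hlim : Tendsto (fun e : ℝ => K * (τ / 2) ^ (-α) * Real.exp (ω * β * (τ / 2)) *
          (V + e) ^ g) (𝓝[>] 0) (𝓝 (K * (τ / 2) ^ (-α) * Real.exp (ω * β * (τ / 2)) *
          V ^ g)) := by
        have hcont : Continuous fun e : ℝ => K * (τ / 2) ^ (-α) *
            Real.exp (ω * β * (τ / 2)) * (V + e) ^ g :=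
          continuous_const.mul ((continuous_const.add continuous_id).rpow_const
            fun _ => Or.inr hg0.le)
        have := hcont.tendsto 0
        simp only [add_zero] at this
        exact this.mono_left nhdsWithin_le_nhds
      refine ge_of_tendsto hlim ?_
      filter_upwards [self_mem_nhdsWithin] with e he
      have he' : (0 : ℝ) < e := he
      exact hlimW _ (by linarith) (h1.trans (by linarith))
    refine hV.trans ?_
    have e1 : ((X (τ / 2) ^ (Q - S) * (Real.exp (ω * (τ / 2)) * W) ^ S) ^ (1 / Q)) ^ g =
        X (τ / 2) ^ δ * (Real.exp (ω * (τ / 2) * (S / Q * g)) * W ^ (S / Q * g)) := by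
      rw [← Real.rpow_mul (by positivity), Real.mul_rpow (by positivity) (by positivity),
        ← Real.rpow_mul hXn, ← Real.rpow_mul (by positivity),
        Real.mul_rpow (Real.exp_pos _).le hW.le, ← Real.exp_mul,
        show (Q - S) * (1 / Q * g) = δ by rw [hδ]; ring,
        show S * (1 / Q * g) = S / Q * g by ring]
    have e2 : (τ / 2) ^ (-α) = 2 ^ α * τ ^ (-α) := by
      rw [Real.div_rpow hτ.le (by norm_num), Real.rpow_neg (by norm_num : (0 : ℝ) ≤ 2),
        div_inv_eq_mul, mul_comm]
    have e3 : Real.exp (ω * β * (τ / 2)) * Real.exp (ω * (τ / 2) * (S / Q * g)) ≤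
        Real.exp (ω * (β + g) * t) := by
      rw [← Real.exp_add]
      refine Real.exp_le_exp.2 ?_
      have h3 : S / Q ≤ 1 := (div_le_one hQ0).2 hSQ.le
      have h4 : S / Q * g ≤ 1 * g := by gcongr
      have h5 : ω * (τ / 2) * (β + S / Q * g) ≤ ω * t * (β + 1 * g) := by
        gcongr
        linarith
      linarith
    rw [e1, e2]
    calc K * (2 ^ α * τ ^ (-α)) * Real.exp (ω * β * (τ / 2)) *
          (X (τ / 2) ^ δ * (Real.exp (ω * (τ / 2) * (S / Q * g)) * W ^ (S / Q * g)))
        = K * 2 ^ α * (Real.exp (ω * β * (τ / 2)) * Real.exp (ω * (τ / 2) * (S / Q * g))) *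
          W ^ (S / Q * g) * τ ^ (-α) * X (τ / 2) ^ δ := by ring
      _ ≤ K' * 2 ^ α * Real.exp (ω * (β + g) * t) *
          W ^ (S / Q * g) * τ ^ (-α) * X (τ / 2) ^ δ := by
          gcongr
          linarith

/-- The growth exponent `β` may be replaced by any number larger than `g`. -/
theorem SmoothingBound.exists_of_lt {α β β' g K : ℝ} (hs : 1 ≤ s) (hK : 0 ≤ K)
    (hβ' : g < β') (h : SmoothingBound.{u} q r s c a b γ α β g K) :
    ∃ K' : ℝ, 0 ≤ K' ∧ SmoothingBound.{u} q r s c a b γ α β' g K' := by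
  rcases le_or_gt β β' with hle | hlt
  · refine ⟨K, hK, fun Ω _ μ T ω hT t ht u u' W hW huW => ?_⟩
    refine (h Ω μ T ω hT t ht u u' W hW huW).trans (ENNReal.ofReal_le_ofReal ?_)
    have := hT.nonneg
    gcongr
  -- The estimate is used only on the last fraction e of the time, after the L^s Lipschitz bound.
  -- The growth exponent becomes eβ + (1 - e)g, which equals β' for this e.
  · set e := (β' - g) / (β - g) with he
    have hβg : 0 < β - g := by linarith
    have he0 : 0 < e := div_pos (by linarith) hβg
    have he1 : e < 1 := (div_lt_one hβg).2 (by linarith)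
    refine ⟨K * e ^ (-α), by positivity, fun Ω _ μ T ω hT t ht u u' W hW huW => ?_⟩
    have h1 : 0 ≤ (1 - e) * t := mul_nonneg (by linarith) ht.le
    have h2 := h Ω μ T ω hT (e * t) (by positivity) (T ((1 - e) * t) u) (T ((1 - e) * t) u')
      (Real.exp (ω * ((1 - e) * t)) * W) (by positivity) (by
        refine (hT.lipschitz _ h1 s hs u u').trans ?_
        rw [ENNReal.ofReal_mul (Real.exp_pos _).le]
        gcongr)
    rw [← hT.add _ _ (by positivity) h1, ← hT.add _ _ (by positivity) h1,
      show e * t + (1 - e) * t = t by ring] at h2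
    refine h2.trans (ENNReal.ofReal_le_ofReal (le_of_eq ?_))
    rw [Real.mul_rpow (Real.exp_pos _).le hW.le, Real.mul_rpow he0.le ht.le, ← Real.exp_mul]
    have e1 : ω * β' * t = ω * β * (e * t) + ω * ((1 - e) * t) * g := by
      have : e * (β - g) = β' - g := div_mul_cancel₀ _ hβg.ne'
      linear_combination (-(ω * t)) * this
    rw [e1, Real.exp_add]
    ring

theorem exists_smoothingBound (hq : q ≠ ∞) (hr : r ≠ ∞) (hs : 1 ≤ s) (hs' : s ≠ ∞)
    (hc : 0 < c) (ha : 0 ≤ a) (hb : 0 ≤ b) (hγ : 0 ≤ γ) (hγ1 : γ ≤ 1)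
    (hγR : q.toReal < γ * r.toReal) {β : ℝ}
    (hβ : (γ * r.toReal / q.toReal - 1) * s.toReal /
      smoothingDenom q.toReal r.toReal s.toReal γ < β) :
    ∃ K : ℝ, 0 ≤ K ∧ SmoothingBound.{u} q r s c a b γ
      (a * r.toReal / smoothingDenom q.toReal r.toReal s.toReal γ) β
      ((γ * r.toReal / q.toReal - 1) * s.toReal /
        smoothingDenom q.toReal r.toReal s.toReal γ) K := by
  have hQ : 1 ≤ q.toReal := one_le_toReal_of_fact hq
  have hS : 1 ≤ s.toReal := by simpa using ENNReal.toReal_mono hs' hs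
  have hR : 0 < r.toReal := by
    by_contra hcon
    push Not at hcon
    nlinarith
  have hE := smoothingDenom_pos (by linarith : 0 < q.toReal) hR (by linarith : 0 < s.toReal)
    hγ1 hγR
  have hκ : 0 < γ * r.toReal / q.toReal - 1 := by
    rw [sub_pos, lt_div_iff₀ (by linarith)]; linarith
  obtain ⟨K, β₀, hK, -, h⟩ : ∃ K β : ℝ, 0 ≤ K ∧ 0 ≤ β ∧ SmoothingBound.{u} q r s c a b γ
      (a * r.toReal / smoothingDenom q.toReal r.toReal s.toReal γ) β
      ((γ * r.toReal / q.toReal - 1) * s.toReal /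
        smoothingDenom q.toReal r.toReal s.toReal γ) K := by
    rcases le_or_gt q s with hqs | hqs
    · exact exists_smoothingBound_of_le hq hr hs' hqs hc ha hb hγ hγ1 hγR
    · exact exists_smoothingBound_of_lt hq hr hs hqs hc ha hb hγ hγ1 hγR
  exact h.exists_of_lt hs hK hβ

end Smoothing

/-! ### Extension of the semigroup to L^s -/

section Extension

variable {Ω : Type*} [MeasurableSpace Ω] {μ : Measure Ω} {q s : ℝ≥0∞} [Fact (1 ≤ q)]
  [Fact (1 ≤ s)]

theorem dense_setOf_memLp (hq : q ≠ ∞) (hs : s ≠ ∞) : Dense {w : Lp ℝ s μ | MemLp w q μ} := by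
  refine (Lp.simpleFunc.dense (E := ℝ) (μ := μ) hs).mono fun w hw => ?_
  set f : Lp.simpleFunc ℝ s μ := ⟨w, hw⟩
  have h1 := Lp.simpleFunc.toSimpleFunc_eq_toFun f
  have h2 := (SimpleFunc.memLp_iff_finMeasSupp ne_zero_of_fact hs).1
    (Lp.simpleFunc.memLp f)
  exact ((SimpleFunc.memLp_iff_finMeasSupp ne_zero_of_fact hq).2 h2).ae_eq h1

theorem memLp_of_one_of_top {f : Ω → ℝ} (h1 : MemLp f 1 μ) (h2 : MemLp f ∞ μ) (hs : s ≠ ∞) :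
    MemLp f s μ := by
  have hS : 1 ≤ s.toReal := one_le_toReal_of_fact hs
  set M := (eLpNormEssSup f μ).toReal
  have hM : eLpNormEssSup f μ = ENNReal.ofReal M := (ENNReal.ofReal_toReal (by
    rw [← eLpNorm_exponent_top]; exact h2.eLpNorm_ne_top)).symm
  refine ⟨h1.1, lt_of_le_of_lt (eLpNorm_le_of_rpow_le (g := f) (c := M ^ (s.toReal - 1))
    (W := (eLpNorm f 1 μ).toReal) ne_zero_of_fact hs one_ne_zero ENNReal.one_ne_top
    (by positivity) ENNReal.toReal_nonneg ?_
    (ENNReal.ofReal_toReal h1.eLpNorm_ne_top).ge) ENNReal.ofReal_lt_top⟩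
  filter_upwards [ae_le_eLpNormEssSup (f := f) (μ := μ)] with x hx
  rw [hM, Real.enorm_eq_ofReal_abs, ENNReal.ofReal_le_ofReal_iff ENNReal.toReal_nonneg] at hx
  rw [ENNReal.toReal_one]
  calc |f x| ^ s.toReal = |f x| ^ (s.toReal - 1) * |f x| ^ (1 : ℝ) := by
        rw [← Real.rpow_add_of_nonneg (abs_nonneg _) (by linarith) zero_le_one]
        congr 1; ring
    _ ≤ _ := by gcongr

variable {F : Lp ℝ q μ → Lp ℝ q μ}

/-- The fixed point u₀ puts F u in L^s for u in L^q ∩ L^s, since F u - u₀ is controlled by u - u₀.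
The Lipschitz bound then extends F by density. -/
theorem exists_isContinuousExtension (hq : q ≠ ∞) (hs : s ≠ ∞) {L : ℝ} (hL0 : 0 ≤ L)
    (hL : ∀ u u', eLpNorm (F u - F u' : Lp ℝ q μ) s μ ≤
      ENNReal.ofReal L * eLpNorm (u - u' : Lp ℝ q μ) s μ)
    {u₀ : Lp ℝ q μ} (hu₀ : MemLp u₀ s μ) (hF : F u₀ = u₀) :
    ∃ S : Lp ℝ s μ → Lp ℝ s μ, IsContinuousExtension F S := by
  set D : Set (Lp ℝ s μ) := {w | MemLp w q μ}
  have hD : Dense D := dense_setOf_memLp hq hs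
  let U : D → Lp ℝ q μ := fun w => w.2.toLp _
  have hU : ∀ w : D, U w =ᵐ[μ] (w : Lp ℝ s μ) := fun w => w.2.coeFn_toLp
  have hmem : ∀ w : D, MemLp (F (U w)) s μ := by
    intro w
    have h1 : MemLp (U w - u₀ : Lp ℝ q μ) s μ :=
      (((Lp.memLp (w : Lp ℝ s μ)).ae_eq (hU w).symm).sub hu₀).ae_eq (Lp.coeFn_sub _ _).symm
    have h2 : MemLp (F (U w) - u₀ : Lp ℝ q μ) s μ := by
      refine ⟨Lp.aestronglyMeasurable _, ?_⟩
      have := hL (U w) u₀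
      rw [hF] at this
      exact this.trans_lt (ENNReal.mul_lt_top ENNReal.ofReal_lt_top h1.2)
    refine (h2.add hu₀).ae_eq ?_
    filter_upwards [Lp.coeFn_sub (F (U w)) u₀] with x hx
    rw [Pi.add_apply, hx, Pi.sub_apply, sub_add_cancel]
  let f : D → Lp ℝ s μ := fun w => (hmem w).toLp _
  have hf : ∀ w : D, f w =ᵐ[μ] F (U w) := fun w => (hmem w).coeFn_toLp
  have hlip : LipschitzWith ⟨L, hL0⟩ f := by
    refine LipschitzWith.of_dist_le_mul fun w w' => ?_
    rw [dist_eq_norm, Subtype.dist_eq, dist_eq_norm]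
    refine norm_le_of_eLpNorm_le (by positivity) ?_
    have h1 : (f w - f w' : Lp ℝ s μ) =ᵐ[μ] (F (U w) - F (U w') : Lp ℝ q μ) := by
      filter_upwards [Lp.coeFn_sub (f w) (f w'), Lp.coeFn_sub (F (U w)) (F (U w')), hf w, hf w']
        with x e1 e2 e3 e4
      rw [e1, e2, Pi.sub_apply, Pi.sub_apply, e3, e4]
    have h2 : (U w - U w' : Lp ℝ q μ) =ᵐ[μ] ((w : Lp ℝ s μ) - w' : Lp ℝ s μ) := by
      filter_upwards [Lp.coeFn_sub (U w) (U w'), Lp.coeFn_sub (w : Lp ℝ s μ) w', hU w, hU w']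
        with x e1 e2 e3 e4
      rw [e1, e2, Pi.sub_apply, Pi.sub_apply, e3, e4]
    rw [eLpNorm_congr_ae h1]
    refine (hL _ _).trans (le_of_eq ?_)
    rw [eLpNorm_congr_ae h2, eLpNorm_eq_ofReal_norm, ← ENNReal.ofReal_mul hL0]
    rfl
  refine ⟨hD.extend f, (hD.uniformContinuous_extend hlip.uniformContinuous).continuous, ?_⟩
  intro u w huw
  have hw : w ∈ D := (Lp.memLp u).ae_eq huw
  rw [hD.extend_of_ind hlip.uniformContinuous ⟨w, hw⟩]
  have h1 : U ⟨w, hw⟩ = u := Lp.ext ((hU ⟨w, hw⟩).trans huw.symm)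
  have h2 := hf ⟨w, hw⟩
  rwa [h1] at h2

theorem IsContinuousExtension.eLpNorm_top_sub_le (hq : q ≠ ∞) (hs : s ≠ ∞)
    {S : Lp ℝ s μ → Lp ℝ s μ} (hS : IsContinuousExtension F S) {κ g : ℝ} (hg : 0 ≤ g)
    (h : ∀ (u u' : Lp ℝ q μ) (W : ℝ), 0 < W →
      eLpNorm (u - u' : Lp ℝ q μ) s μ ≤ ENNReal.ofReal W →
      eLpNorm (F u - F u' : Lp ℝ q μ) ∞ μ ≤ ENNReal.ofReal (κ * W ^ g)) (w w' : Lp ℝ s μ) :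
    eLpNorm (S w - S w' : Lp ℝ s μ) ∞ μ ≤ ENNReal.ofReal (κ * ‖w - w'‖ ^ g) := by
  have hD : Dense {w : Lp ℝ s μ | MemLp w q μ} := dense_setOf_memLp hq hs
  obtain ⟨x, hx, hxw⟩ := mem_closure_iff_seq_limit.1 (hD w)
  obtain ⟨y, hy, hyw⟩ := mem_closure_iff_seq_limit.1 (hD w')
  have hlim : Tendsto (fun n => S (x n) - S (y n)) atTop (𝓝 (S w - S w')) :=
    ((hS.1.tendsto w).comp hxw).sub ((hS.1.tendsto w').comp hyw)
  -- The summand 1/(n + 1) keeps the radius positive, as the hypothesis demands.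
  have hW : Tendsto (fun n : ℕ => ENNReal.ofReal
      (κ * (‖x n - y n‖ + 1 / ((n : ℝ) + 1)) ^ g)) atTop
      (𝓝 (ENNReal.ofReal (κ * ‖w - w'‖ ^ g))) := by
    have h1 := (hxw.sub hyw).norm.add tendsto_one_div_add_atTop_nhds_zero_nat
    rw [add_zero] at h1
    exact (ENNReal.continuous_ofReal.tendsto _).comp
      ((h1.rpow_const (Or.inr hg)).const_mul κ)
  refine eLpNorm_le_of_tendsto_Lp hlim (Eventually.of_forall fun n => ?_) hW
  have hxU := (hx n).coeFn_toLp
  have hyU := (hy n).coeFn_toLp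
  set u := (hx n).toLp _
  set u' := (hy n).toLp _
  have h1 : (S (x n) - S (y n) : Lp ℝ s μ) =ᵐ[μ] (F u - F u' : Lp ℝ q μ) := by
    filter_upwards [Lp.coeFn_sub (S (x n)) (S (y n)), Lp.coeFn_sub (F u) (F u'),
      hS.2 u (x n) hxU, hS.2 u' (y n) hyU] with z e1 e2 e3 e4
    rw [e1, e2, Pi.sub_apply, Pi.sub_apply, e3, e4]
  have h2 : (u - u' : Lp ℝ q μ) =ᵐ[μ] (x n - y n : Lp ℝ s μ) := by
    filter_upwards [Lp.coeFn_sub u u', Lp.coeFn_sub (x n) (y n), hxU, hyU] with z e1 e2 e3 e4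
    rw [e1, e2, Pi.sub_apply, Pi.sub_apply, e3, e4]
  rw [eLpNorm_congr_ae h1]
  refine h u u' _ (by positivity) ?_
  rw [eLpNorm_congr_ae h2, eLpNorm_eq_ofReal_norm]
  exact ENNReal.ofReal_le_ofReal (by
    have : 0 < 1 / ((n : ℝ) + 1) := by positivity
    linarith)

end Extension

/-! ### Identification of the exponents -/

section Exponents

variable {Q R γ m₀ S σ : ℝ}

/-- This is why m₀ disappears from α_s and γ_s: it occurs here only through the factor (γR/Q) D,
which the numerators of both cancel. -/
theorem one_sub_gammaStar_mul (hQ : 0 < Q) (hR : 0 < R) (hγ : 0 < γ) (hm₀ : 0 < m₀)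
    (hD : 0 < expDenom Q R γ m₀) :
    1 - gammaStar Q R γ m₀ * (1 - thetaS Q R γ m₀ S) =
      smoothingDenom Q R S γ / (γ * R / Q * expDenom Q R γ m₀) := by
  have hD' := hD.ne'
  have e1 : 1 - gammaStar Q R γ m₀ * (1 - thetaS Q R γ m₀ S) =
      (expDenom Q R γ m₀ - (γ * R / Q - 1) * m₀ * (1 - thetaS Q R γ m₀ S)) /
        expDenom Q R γ m₀ := by
    unfold gammaStar
    field_simp
  have e2 : expDenom Q R γ m₀ - (γ * R / Q - 1) * m₀ * (1 - thetaS Q R γ m₀ S) =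
      smoothingDenom Q R S γ / (γ * R / Q) := by
    unfold expDenom smoothingDenom thetaS
    field_simp
    ring
  rw [e1, e2, div_div]

theorem alphaS_eq (hQ : 0 < Q) (hR : 0 < R) (hγ : 0 < γ) (hm₀ : 0 < m₀)
    (hD : 0 < expDenom Q R γ m₀) :
    alphaS Q R σ γ m₀ S = 1 / σ * R / smoothingDenom Q R S γ := by
  have hD' := hD.ne'
  rw [alphaS, one_sub_gammaStar_mul hQ hR hγ hm₀ hD, alphaStar]
  field_simp

theorem gammaStar_mul_thetaS (hQ : 0 < Q) (hR : 0 < R) (hγ : 0 < γ) (hm₀ : 0 < m₀) :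
    gammaStar Q R γ m₀ * thetaS Q R γ m₀ S =
      (γ * R / Q - 1) * S / (γ * R / Q * expDenom Q R γ m₀) := by
  unfold gammaStar thetaS
  field_simp

theorem gammaS_eq (hQ : 0 < Q) (hR : 0 < R) (hγ : 0 < γ) (hm₀ : 0 < m₀)
    (hD : 0 < expDenom Q R γ m₀) :
    gammaS Q R γ m₀ S = (γ * R / Q - 1) * S / smoothingDenom Q R S γ := by
  rw [gammaS, one_sub_gammaStar_mul hQ hR hγ hm₀ hD, gammaStar_mul_thetaS hQ hR hγ hm₀,
    div_div_div_cancel_right₀ (by positivity)]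

/-- Over the denominator D, the numerator exceeds γ + Q/γ - 1 - Q = (1 - γ)(Q - γ)/γ, which is
nonnegative as γ ≤ 1 ≤ Q. -/
theorem betaStar_pos (hQ : 1 ≤ Q) (hγ : 0 < γ) (hγ1 : γ ≤ 1) (hγR : Q < γ * R)
    (hm₀ : Q / γ ≤ m₀) (hD : 0 < expDenom Q R γ m₀) : 0 < betaStar Q R γ m₀ := by
  have hQ0 : 0 < Q := by linarith
  have hκ : 1 < γ * R / Q := by rw [lt_div_iff₀ hQ0]; linarith
  rw [betaStar, div_add_one hD.ne']
  refine div_pos ?_ hD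
  have h1 : γ ^ 2 * R / Q = γ * (γ * R / Q) := by ring
  have h2 : Q * (1 / γ - 1) = Q / γ - Q := by ring
  rw [expDenom, h1, h2]
  set κ := γ * R / Q
  have h3 : (κ - 1) * (Q / γ) ≤ (κ - 1) * m₀ := mul_le_mul_of_nonneg_left hm₀ (by linarith)
  have h4 : γ * 1 < γ * κ := mul_lt_mul_of_pos_left hκ hγ
  have h5 : 0 < (κ - 1) * (Q / γ) := mul_pos (by linarith) (by positivity)
  have h6 : γ + Q / γ - 1 - Q = (1 - γ) * (Q - γ) / γ := by field_simp; ring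
  have h7 : 0 ≤ (1 - γ) * (Q - γ) / γ :=
    div_nonneg (mul_nonneg (by linarith) (by linarith)) hγ.le
  linarith

/-- The numerators differ by β*/2 > 0. The strict inequality is what `SmoothingBound.exists_of_lt`
needs to reach the growth exponent β_s. -/
theorem gammaS_lt_betaS (hQ : 1 ≤ Q) (hR : 0 < R) (hγ : 0 < γ) (hγ1 : γ ≤ 1) (hγR : Q < γ * R)
    (hm₀ : Q / γ ≤ m₀) (hD : 0 < expDenom Q R γ m₀) (hS : 0 < S) :
    gammaS Q R γ m₀ S < betaS Q R γ m₀ S := by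
  have hQ0 : 0 < Q := by linarith
  have hm0 : 0 < m₀ := lt_of_lt_of_le (by positivity) hm₀
  have hE := smoothingDenom_pos hQ0 hR hS hγ1 hγR
  have hβ := betaStar_pos hQ hγ hγ1 hγR hm₀ hD
  unfold gammaS betaS
  rw [one_sub_gammaStar_mul hQ0 hR hγ hm0 hD]
  refine div_lt_div_of_pos_right ?_ (by positivity)
  linarith

end Exponents

end NonlinearSemigroup

/-! ### The main theorem -/

theorem mainTheorem1 (q r : ℝ≥0∞) [Fact (1 ≤ q)] (hq : q ≠ ∞) (hr : 1 ≤ r)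
    (ρ σ C : ℝ) (hρ : 0 ≤ ρ) (hσ : 0 < σ) (hC : 0 < C)
    (γ : ℝ) (hγ : γ = (q.toReal + ρ) / σ) :
    ∃ K : ℝ → ℝ≥0∞ → ℝ,
      ∀ (Ω : Type*) [MeasurableSpace Ω] (μ : Measure Ω) [SigmaFinite μ]
        (ω : ℝ) (A : Set (Lp ℝ q μ × Lp ℝ q μ)),
        0 ≤ ω →
        NonlinearSemigroup.IsMCompletelyAccretive (NonlinearSemigroup.addScalarId A ω) →
        Dense (NonlinearSemigroup.effDomain A) →
        NonlinearSemigroup.GagliardoNirenberg A r ρ σ ω C →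
        -- the semigroup generated by `-A` is well defined on `L^q`
        (∀ (t : ℝ) (u : Lp ℝ q μ), 0 ≤ t →
          Tendsto (NonlinearSemigroup.expApprox A t u) atTop
            (𝓝 (NonlinearSemigroup.semigroup A t u))) ∧
        -- the `L^q`-`L^r` estimate
        (∀ (t : ℝ) (u u' : Lp ℝ q μ), 0 < t →
          eLpNorm (NonlinearSemigroup.semigroup A t u - NonlinearSemigroup.semigroup A t u' :
              Lp ℝ q μ) r μ ≤
            ENNReal.ofReal ((C / q.toReal) ^ (1 / σ) * t ^ (-(1 / σ)) *
              Real.exp (ω * (γ + 1) * t) * ‖u - u'‖ ^ γ)) ∧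
        -- the `L^s`-`L^∞` estimates
        (r ≠ ∞ → q.toReal < γ * r.toReal →
          (∃ u₀ : Lp ℝ q μ, MemLp u₀ 1 μ ∧ MemLp u₀ ∞ μ ∧ (u₀, (0 : Lp ℝ q μ)) ∈ A) →
          ∀ m₀ : ℝ, q.toReal / γ ≤ m₀ →
            0 < NonlinearSemigroup.expDenom q.toReal r.toReal γ m₀ →
            ∀ (s : ℝ≥0∞) [Fact (1 ≤ s)],
              s ≤ ENNReal.ofReal (γ * r.toReal / q.toReal * m₀) →
              γ * (1 - NonlinearSemigroup.thetaS q.toReal r.toReal γ m₀ s.toReal) < 1 →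
              ∃ S : ℝ → Lp ℝ s μ → Lp ℝ s μ,
                (∀ t : ℝ, 0 ≤ t →
                  NonlinearSemigroup.IsContinuousExtension
                    (NonlinearSemigroup.semigroup A t) (S t)) ∧
                ∀ (t : ℝ) (u u' : Lp ℝ s μ), 0 < t →
                  eLpNorm (S t u - S t u' : Lp ℝ s μ) ∞ μ ≤
                    ENNReal.ofReal (K m₀ s *
                      t ^ (-NonlinearSemigroup.alphaS q.toReal r.toReal σ γ m₀ s.toReal) *
                      Real.exp (ω *
                        NonlinearSemigroup.betaS q.toReal r.toReal γ m₀ s.toReal * t) *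
                      ‖u - u'‖ ^
                        NonlinearSemigroup.gammaS q.toReal r.toReal γ m₀ s.toReal)) := by
  have hQ : 1 ≤ q.toReal := NonlinearSemigroup.one_le_toReal_of_fact hq
  have hQ0 : 0 < q.toReal := by linarith
  have hγ0 : 0 < γ := by rw [hγ]; positivity
  have hc : 0 < (C / q.toReal) ^ (1 / σ) := by positivity
  -- The constant is chosen before the measure space, ω and A are introduced, with the default 0 at
  -- inadmissible parameters.
  have hK : ∀ (m₀ : ℝ) (s : ℝ≥0∞), ∃ K : ℝ, r ≠ ∞ → q.toReal < γ * r.toReal → γ ≤ 1 →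
      q.toReal / γ ≤ m₀ → 0 < NonlinearSemigroup.expDenom q.toReal r.toReal γ m₀ →
      1 ≤ s → s ≠ ∞ →
      NonlinearSemigroup.SmoothingBound q r s ((C / q.toReal) ^ (1 / σ)) (1 / σ) (γ + 1) γ
        (NonlinearSemigroup.alphaS q.toReal r.toReal σ γ m₀ s.toReal)
        (NonlinearSemigroup.betaS q.toReal r.toReal γ m₀ s.toReal)
        (NonlinearSemigroup.gammaS q.toReal r.toReal γ m₀ s.toReal) K := by
    intro m₀ s
    by_cases h : r ≠ ∞ ∧ q.toReal < γ * r.toReal ∧ γ ≤ 1 ∧ q.toReal / γ ≤ m₀ ∧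
      0 < NonlinearSemigroup.expDenom q.toReal r.toReal γ m₀ ∧ 1 ≤ s ∧ s ≠ ∞
    · obtain ⟨hr', hγr, hγ1, hm₀, hD, hs, hs'⟩ := h
      have hR : 0 < r.toReal := pos_of_mul_pos_right (hQ0.trans hγr) hγ0.le
      have hS : 0 < s.toReal := ENNReal.toReal_pos (zero_lt_one.trans_le hs).ne' hs'
      have hm0 : 0 < m₀ := lt_of_lt_of_le (by positivity) hm₀
      have hlt := NonlinearSemigroup.gammaS_lt_betaS hQ hR hγ0 hγ1 hγr hm₀ hD hS
      rw [NonlinearSemigroup.gammaS_eq hQ0 hR hγ0 hm0 hD] at hlt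
      obtain ⟨K, -, hKb⟩ := NonlinearSemigroup.exists_smoothingBound hq hr' hs hs' hc
        (by positivity : 0 ≤ 1 / σ) (by positivity : 0 ≤ γ + 1) hγ0.le hγ1 hγr hlt
      refine ⟨K, fun _ _ _ _ _ _ _ => ?_⟩
      rw [NonlinearSemigroup.alphaS_eq hQ0 hR hγ0 hm0 hD,
        NonlinearSemigroup.gammaS_eq hQ0 hR hγ0 hm0 hD]
      exact hKb
    · exact ⟨0, fun h1 h2 h3 h4 h5 h6 h7 => absurd ⟨h1, h2, h3, h4, h5, h6, h7⟩ h⟩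
  choose K hK using hK
  refine ⟨K, ?_⟩
  intro Ω _ μ _ ω A hω hA hD hGN
  have hM := hA.isQuasiMAccretive hω
  have hLr : ∀ (t : ℝ) (u u' : Lp ℝ q μ), 0 < t →
      eLpNorm (NonlinearSemigroup.semigroup A t u - NonlinearSemigroup.semigroup A t u' :
        Lp ℝ q μ) r μ ≤
      ENNReal.ofReal ((C / q.toReal) ^ (1 / σ) * t ^ (-(1 / σ)) *
        Real.exp (ω * (γ + 1) * t) * ‖u - u'‖ ^ γ) := by
    intro t u u' ht
    rw [hγ]
    exact NonlinearSemigroup.eLpNorm_semigroup_sub_le_of_gagliardoNirenberg hq hr hρ hσ hC hω hA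
      hD hGN ht u u'
  refine ⟨fun t u ht => hM.tendsto_expApprox hD ht u, hLr, ?_⟩
  rintro hr' hγr ⟨u₀, hu₁, hu_top, hu₀⟩ m₀ hm₀ hDen s _ hs -
  have hs' : s ≠ ∞ := ne_top_of_le_ne_top ENNReal.ofReal_ne_top hs
  have hs1 : 1 ≤ s := Fact.out
  rcases le_or_gt γ 1 with hγ1 | hγ1
  · have hR : 0 < r.toReal := pos_of_mul_pos_right (hQ0.trans hγr) hγ0.le
    have hS : 0 < s.toReal := ENNReal.toReal_pos (zero_lt_one.trans_le hs1).ne' hs'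
    have hm0 : 0 < m₀ := lt_of_lt_of_le (by positivity) hm₀
    have hT : NonlinearSemigroup.IsRegularizing (NonlinearSemigroup.semigroup A) r
        ((C / q.toReal) ^ (1 / σ)) (1 / σ) (γ + 1) γ ω :=
      ⟨hω, NonlinearSemigroup.semigroup_zero, fun t s ht hs u => hM.semigroup_add hD ht hs u,
        fun t ht p hp u u' => hA.eLpNorm_semigroup_sub_le hω hD ht hp u u',
        fun t ht u u' => hLr t u u' ht⟩
    have hext : ∀ t : ℝ, ∃ S : Lp ℝ s μ → Lp ℝ s μ, 0 ≤ t →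
        NonlinearSemigroup.IsContinuousExtension (NonlinearSemigroup.semigroup A t) S := by
      intro t
      by_cases ht : 0 ≤ t
      · obtain ⟨S, hS⟩ := NonlinearSemigroup.exists_isContinuousExtension hq hs'
          (Real.exp_pos _).le (hT.lipschitz t ht s hs1)
          (NonlinearSemigroup.memLp_of_one_of_top hu₁ hu_top hs') (hM.semigroup_eq_of_mem hD ht hu₀)
        exact ⟨S, fun _ => hS⟩
      · exact ⟨id, fun h => absurd h ht⟩
    choose S hSext using hext
    refine ⟨S, hSext, fun t u u' ht => ?_⟩
    refine (hSext t ht.le).eLpNorm_top_sub_le hq hs' ?_ ?_ u u'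
    · rw [NonlinearSemigroup.gammaS_eq hQ0 hR hγ0 hm0 hDen]
      have hE := NonlinearSemigroup.smoothingDenom_pos hQ0 hR hS hγ1 hγr
      have hκ : 0 < γ * r.toReal / q.toReal - 1 := by
        rw [sub_pos, lt_div_iff₀ hQ0]; linarith
      positivity
    · exact hK m₀ s hr' hγr hγ1 hm₀ hDen hs1 hs' Ω μ _ ω hT t ht
  · -- for `γ > 1` the Hölder estimate makes the semigroup constant, so that `L^q` is trivial
    have hconst : ∀ t : ℝ, 0 < t → ∀ u u' : Lp ℝ q μ,
        NonlinearSemigroup.semigroup A t u = NonlinearSemigroup.semigroup A t u' := fun t ht =>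
      NonlinearSemigroup.eq_of_eLpNorm_sub_le_rpow hr (by positivity) hγ1
        fun u u' => hLr t u u' ht
    have hμ : μ = 0 := NonlinearSemigroup.measure_eq_zero_of_subsingleton_Lp hq
      (hM.subsingleton_of_semigroup_const hD hconst)
    subst hμ
    refine ⟨fun _ _ => 0, fun t _ => ⟨continuous_const, fun u w _ => ?_⟩, fun t u u' _ => ?_⟩
    · simp [Filter.EventuallyEq]
    · rw [eLpNorm_measure_zero]
      exact bot_le
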